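/- A charging station has $K\in\{1,2,\dots\}\cup\{\infty\}$ parking spaces and power $M$, where $M$ is a real number with $0<M\le K$. Let $\lambda,\mu,\nu>0$. Let $Q^K_M(t)$ be the total number of electric vehicles in the station at time $t$, $Z^K_M(t)$ the number of those that are not fully charged, and $C^K_M(t)=Q^K_M(t)-Z^K_M(t)$ the number of fully charged ones. The process $(Q^K_M,Z^K_M)$ is the continuous-time Markov process on $\{(q,z)\in\mathbb{Z}_{\ge 0}^2: z\le q\le K,\ q<\infty\}$ with transition rates $$(q,z)\to(q+1,z+1):\ \lambda \mathbf 1_{\{q<K\}},\qquad (q,z)\to(q,z-1):\ \mu\min(z,M),$$ $$(q,z)\to(q-1,z-1):\ \nu z,\qquad (q,z)\to(q-1,z):\ \nu(q-z).$$ For finite $K$, let $Z_f(t)$ (the number of uncharged vehicles in a parking lot that is always full) be the birth-death process on $\{0,\dots,K\}$ with birth rate $\nu(K-z)$ and death rate $\mu\min(z,M)$ in state $z$. Write $X(\infty)$ for a random variable distributed according to the steady-state (limiting, as $t\to\infty$) law of the process $X$. Let $K\in\{1,2,\dots\}$ be finite and $0<M\le K$. Then all the steady-state expectations below are finite, $\mathbb{E}[Q^{\infty}_M(\infty)]>0$,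 $\mathbb{E}[Q^{K}_M(\infty)]>0$, and $$\frac{\mathbb{E}[C^{\infty}_M(\infty)]}{\mathbb{E}[Q^{\infty}_M(\infty)]}\ \le\ \frac{\mathbb{E}[C^{K}_M(\infty)]}{\mathbb{E}[Q^{K}_M(\infty)]}\ \le\ \frac{\mathbb{E}[C^{K}_K(\infty)]}{\mathbb{E}[Q^{K}_M(\infty)]},$$ $$\frac{\mathbb{E}[Q^{K}_M(\infty)]-\mathbb{E}[Z_f(\infty)]}{\mathbb{E}[Q^{K}_M(\infty)]}\ \le\ \frac{\mathbb{E}[C^{K}_M(\infty)]}{\mathbb{E}[Q^{K}_M(\infty)]}.$$ -/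

import Mathlib

open MeasureTheory ProbabilityTheory Filter Topology
open scoped NNReal ENNReal

/-- The law on path space of the continuous-time Markov chain with state space `E` (a subset of the
discrete space `S`) and generator `A`, through its martingale problem: `X` is an `E`-valued process
whose paths are right-continuous with left limits, and for every finitely supported `f`,
`f (X t) - ∫₀ᵗ (A f) (X s) ds` is a martingale with respect to a filtration to which `X` is adapted.
The initial distribution is arbitrary. -/
structure IsMarkovJumpProcess {Ω : Type*} [mΩ : MeasurableSpace Ω]
    {S : Type*} [TopologicalSpace S] [DiscreteTopology S]
    (A : (S → ℝ) → S → ℝ) (E : Set S) (P : Measure Ω) (X : ℝ≥0 → Ω → S) : Prop where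
  mem_states : ∀ t ω, X t ω ∈ E
  right_continuous : ∀ ω t, ContinuousWithinAt (fun s => X s ω) (Set.Ici t) t
  left_limits : ∀ ω t, ∃ l, Tendsto (fun s => X s ω) (𝓝[<] t) (𝓝 l)
  martingale : ∃ 𝓕 : Filtration ℝ≥0 mΩ, StronglyAdapted 𝓕 X ∧
    ∀ f : S → ℝ, (Function.support f).Finite →
      Martingale (fun t ω => f (X t ω) - ∫ s in (0 : ℝ)..t, A f (X s.toNNReal ω)) 𝓕 P

/-- `π` is the law of `X(∞)`: a probability measure such that
`ℙ(X t = x) → π {x}` as `t → ∞`, for every state `x`. -/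
structure IsSteadyStateLaw {Ω : Type*} [MeasurableSpace Ω] {S : Type*} [MeasurableSpace S]
    (P : Measure Ω) (X : ℝ≥0 → Ω → S) (π : Measure S) : Prop where
  isProbabilityMeasure : IsProbabilityMeasure π
  tendsto : ∀ x : S, Tendsto (fun t => P (X t ⁻¹' {x})) atTop (𝓝 (π {x}))

namespace Charging

/-- The states `(q, z)` of the charging station with `K` parking spaces (`K = ⊤` allowed):
`q` vehicles in total, `z` of which are not fully charged. -/
def states (K : ℕ∞) : Set (ℕ × ℕ) := {x | x.2 ≤ x.1 ∧ (x.1 : ℕ∞) ≤ K}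

/-- The generator of `(Q, Z)`: arrivals of uncharged vehicles at rate `lam` while `q < K`,
completions of a charge at total rate `μ (z ∧ M)`, departures of uncharged vehicles at
total rate `ν z`, departures of fully charged vehicles at total rate `ν (q - z)`.
(A truncated subtraction `0 - 1` only occurs at rate `0`.) -/
noncomputable def generator (lam μ ν : ℝ) (K : ℕ∞) (M : ℝ) (f : ℕ × ℕ → ℝ) (x : ℕ × ℕ) : ℝ :=
  (if (x.1 : ℕ∞) < K then lam else 0) * (f (x.1 + 1, x.2 + 1) - f x)
    + μ * min (x.2 : ℝ) M * (f (x.1, x.2 - 1) - f x)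
    + ν * (x.2 : ℝ) * (f (x.1 - 1, x.2 - 1) - f x)
    + ν * ((x.1 : ℝ) - (x.2 : ℝ)) * (f (x.1 - 1, x.2) - f x)

/-- `Y = (Q, Z)` is the process of total and uncharged numbers of vehicles in the charging station
with `K` parking spaces and power `M`. -/
def IsStation {Ω : Type*} [MeasurableSpace Ω] (lam μ ν : ℝ) (K : ℕ∞) (M : ℝ)
    (P : Measure Ω) (Y : ℝ≥0 → Ω → ℕ × ℕ) : Prop :=
  IsMarkovJumpProcess (generator lam μ ν K M) (states K) P Y

/-- The generator of the number of uncharged vehicles in the full parking lot: birth rate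
`ν (K - z)`, death rate `μ (z ∧ M)`. -/
noncomputable def fullGenerator (μ ν : ℝ) (K : ℕ) (M : ℝ) (f : ℕ → ℝ) (z : ℕ) : ℝ :=
  ν * ((K : ℝ) - (z : ℝ)) * (f (z + 1) - f z) + μ * min (z : ℝ) M * (f (z - 1) - f z)

/-- `Zf` is the number of uncharged vehicles in the parking lot that is always full. -/
def IsFullLot {Ω : Type*} [MeasurableSpace Ω] (μ ν : ℝ) (K : ℕ) (M : ℝ)
    (P : Measure Ω) (Zf : ℝ≥0 → Ω → ℕ) : Prop :=
  IsMarkovJumpProcess (fullGenerator μ ν K M) {z | z ≤ K} P Zf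

/-- `𝔼[Q(∞)]` when `π` is the law of `(Q(∞), Z(∞))`. -/
noncomputable def meanTotal (π : Measure (ℕ × ℕ)) : ℝ := ∫ x, (x.1 : ℝ) ∂π

/-- `𝔼[C(∞)]`, `C = Q - Z`, when `π` is the law of `(Q(∞), Z(∞))`. -/
noncomputable def meanCharged (π : Measure (ℕ × ℕ)) : ℝ := ∫ x, ((x.1 : ℝ) - (x.2 : ℝ)) ∂π

end Charging

/-! Write `p q z` for the stationary weights. Summing the global balance equations over cuts yields
the two marginals. Across levels of the total, Q is a birth-death process whose law does not involve
M. Across levels of the uncharged number, arrivals balance charging and departures of uncharged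
vehicles: (μ min(z+1,M) + ν(z+1)) u(z+1) = Σ_q a(q) p(q,z), where u is the law of Z and a(q) the
arrival rate. Computing the total arrival rate both ways gives νE[Q] = νE[Z] + μE[min(Z,M)], so E[C]
= (μ/ν) E[min(Z,M)].

First bound: E[C]/E[Q] increases with E[min(Z,M)]/E[Z]. Blocking turns the column recursion into an
inequality, while K = ∞ gives equality; hence the finite-capacity law of Z is smaller in likelihood
ratio. As min(z,M)/z is nonincreasing, the finite station has the larger quotient.

Second bound: E[Q] is common to both powers. With power K the minimum equals Z, so (μ+ν)E[Z_K] =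
νE[Q] ≤ (μ+ν)E[Z].

Third bound: it suffices that E[Z] ≤ E[Z_f]. The net flux U(q,z) through level z within {Q ≤ q}
vanishes for z = 0, z > q and q = K, and is superharmonic for a nearest-neighbour operator, so U ≥ 0
by a minimum principle. Its sums V(z) over q < K control the defect of u in the detailed balance of
the full lot. Pairing that defect with the decrements D of a solution of Poisson's equation for the
cost z - E[Z_f] gives E[Z_f] - E[Z]. Since D is nonnegative and nondecreasing and V ≥ 0, Abel
summation shows this to be nonnegative. -/

/-! ### From the martingale problem to stationarity of the limit law -/

section Stationarity

variable {Ω : Type*} [mΩ : MeasurableSpace Ω] {S : Type*} [TopologicalSpace S] [DiscreteTopology S]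
  {A : (S → ℝ) → S → ℝ} {E : Set S} {P : Measure Ω} {X : ℝ≥0 → Ω → S}

/-- A real function of a right-continuous process with values in a discrete space is jointly
measurable in time and chance. -/
theorem IsMarkovJumpProcess.measurable_uncurry (h : IsMarkovJumpProcess A E P X) (F : S → ℝ) :
    Measurable (fun x : ℝ × Ω => F (X x.1.toNNReal x.2)) := by
  obtain ⟨𝓕, hX, -⟩ := h.martingale
  have hmeas : ∀ t, Measurable (fun ω => F (X t ω)) := fun t =>
    (continuous_of_discreteTopology.comp_stronglyMeasurable ((hX t).mono (𝓕.le t))).measurable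
  -- Grid times approaching `s.toNNReal` from the right, the side on which paths are continuous;
  -- each takes countably many values.
  let k : ℕ → ℝ → ℝ≥0 := fun n s => ((⌊((n : ℝ) + 1) * s⌋₊ + 1 : ℕ) : ℝ≥0) / ((n : ℝ≥0) + 1)
  refine measurable_of_tendsto_metrizable (f := fun n (x : ℝ × Ω) => F (X (k n x.1) x.2))
    (fun n => ?_) ?_
  · have h1 : Measurable (fun y : ℕ × Ω => F (X (((y.1 + 1 : ℕ) : ℝ≥0) / ((n : ℝ≥0) + 1)) y.2)) :=
      measurable_from_prod_countable_right fun m => hmeas (((m + 1 : ℕ) : ℝ≥0) / ((n : ℝ≥0) + 1))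
    have h2 : Measurable (fun x : ℝ × Ω => (⌊((n : ℝ) + 1) * x.1⌋₊, x.2)) :=
      (Nat.measurable_floor.comp (measurable_fst.const_mul _)).prodMk measurable_snd
    exact h1.comp h2
  · rw [tendsto_pi_nhds]
    rintro ⟨s, ω⟩
    have hk : Tendsto (fun n => k n s) atTop (𝓝[Set.Ici s.toNNReal] s.toNNReal) := by
      have hlow : ∀ n, s ≤ ((k n s : ℝ≥0) : ℝ) := by
        intro n
        have : ((n : ℝ) + 1) * s ≤ (⌊((n : ℝ) + 1) * s⌋₊ : ℝ) + 1 := (Nat.lt_floor_add_one _).le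
        simp only [k]
        push_cast
        rw [le_div_iff₀ (by positivity)]
        linarith
      have hup : ∀ n, ((k n s : ℝ≥0) : ℝ) ≤ s.toNNReal + 1 / ((n : ℝ) + 1) := by
        intro n
        have h0 : (⌊((n : ℝ) + 1) * s⌋₊ : ℝ) ≤ ((n : ℝ) + 1) * s.toNNReal := by
          rcases le_total 0 s with hs | hs
          · rw [Real.coe_toNNReal s hs]
            exact Nat.floor_le (by positivity)
          · rw [Nat.floor_of_nonpos (mul_nonpos_of_nonneg_of_nonpos (by positivity) hs)]
            simp only [Nat.cast_zero]
            positivity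
        simp only [k]
        push_cast
        rw [div_le_iff₀ (by positivity)]
        have : ((s.toNNReal : ℝ) + 1 / ((n : ℝ) + 1)) * ((n : ℝ) + 1)
            = ((n : ℝ) + 1) * s.toNNReal + 1 := by field_simp
        linarith
      have hlow' : ∀ n, s.toNNReal ≤ k n s := fun n => Real.toNNReal_le_iff_le_coe.2 (hlow n)
      refine tendsto_nhdsWithin_iff.2 ⟨?_, Eventually.of_forall hlow'⟩
      rw [← NNReal.tendsto_coe]
      refine tendsto_of_tendsto_of_tendsto_of_le_of_le tendsto_const_nhds ?_
        (fun n => NNReal.coe_le_coe.2 (hlow' n)) hup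
      simpa using (tendsto_const_nhds (x := (s.toNNReal : ℝ))).add
        (tendsto_one_div_add_atTop_nhds_zero_nat (𝕜 := ℝ))
    exact (continuous_of_discreteTopology (f := F)).continuousAt.tendsto.comp
      ((h.right_continuous ω s.toNNReal).tendsto.comp hk)

/-- The steady-state law of a Markov jump process is stationary for its generator. -/
theorem IsSteadyStateLaw.sum_generator_eq_zero [MeasurableSpace S] [MeasurableSingletonClass S]
    [IsProbabilityMeasure P] {π : Measure S} (hπ : IsSteadyStateLaw P X π)
    (h : IsMarkovJumpProcess A E P X) {f : S → ℝ} (hf : (Function.support f).Finite)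
    (s : Finset S) (hs : ∀ x ∈ E, x ∉ s → A f x = 0) :
    ∑ x ∈ s, A f x * π.real {x} = 0 := by
  classical
  have := hπ.isProbabilityMeasure
  obtain ⟨𝓕, hX, hmart⟩ := h.martingale
  have hmart := hmart f hf
  have hpre : ∀ t (x : S), MeasurableSet (X t ⁻¹' {x}) := fun t x => by
    have h1 : Measurable (fun ω => ({x} : Set S).indicator (fun _ => (1 : ℝ)) (X t ω)) :=
      (continuous_of_discreteTopology.comp_stronglyMeasurable ((hX t).mono (𝓕.le t))).measurable
    convert h1 (measurableSet_singleton (1 : ℝ)) using 1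
    ext ω
    by_cases hω : X t ω = x <;> simp [hω]
  have hfin : ∀ (F : S → ℝ) (s : Finset S), (∀ x ∈ E, x ∉ s → F x = 0) → ∀ t ω,
      F (X t ω) = ∑ x ∈ s, F x * (X t ⁻¹' {x}).indicator (fun _ => (1 : ℝ)) ω := by
    intro F s hF t ω
    rw [Finset.sum_eq_single (X t ω)]
    · simp
    · intro b _ hb
      simp [Set.indicator, hb.symm]
    · intro hb
      simp [hF _ (h.mem_states t ω) hb]
  have hexp : ∀ (F : S → ℝ) (s : Finset S), (∀ x ∈ E, x ∉ s → F x = 0) → ∀ t,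
      ∫ ω, F (X t ω) ∂P = ∑ x ∈ s, F x * P.real (X t ⁻¹' {x}) := by
    intro F s hF t
    simp_rw [hfin F s hF t]
    rw [integral_finsetSum]
    · refine Finset.sum_congr rfl fun x _ => ?_
      rw [integral_const_mul, integral_indicator_const _ (hpre t x)]
      simp
    · intro x _
      exact ((integrable_const _).indicator (hpre t x)).const_mul _
  have hlim : ∀ (F : S → ℝ) (s : Finset S), (∀ x ∈ E, x ∉ s → F x = 0) →
      Tendsto (fun t => ∫ ω, F (X t ω) ∂P) atTop (𝓝 (∑ x ∈ s, F x * π.real {x})) := by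
    intro F s hF
    simp_rw [hexp F s hF]
    refine tendsto_finsetSum _ fun x _ => Tendsto.const_mul _ ?_
    exact (ENNReal.tendsto_toReal (measure_ne_top π _)).comp (hπ.tendsto x)
  have hbdd : ∀ t ω, ‖A f (X t ω)‖ ≤ ∑ x ∈ s, ‖A f x‖ := by
    intro t ω
    by_cases hx : X t ω ∈ s
    · exact Finset.single_le_sum (f := fun x => ‖A f x‖) (fun _ _ => norm_nonneg _) hx
    · rw [hs _ (h.mem_states t ω) hx, norm_zero]
      exact Finset.sum_nonneg fun _ _ => norm_nonneg _
  have hjm := h.measurable_uncurry (A f)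
  have hint : ∀ ω (a b : ℝ), IntervalIntegrable (fun u => A f (X u.toNNReal ω)) volume a b := by
    intro ω a b
    rw [intervalIntegrable_iff]
    refine Measure.integrableOn_of_bounded (M := ∑ x ∈ s, ‖A f x‖) ?_ ?_ ?_
    · simp
    · exact (hjm.comp measurable_prodMk_right).aestronglyMeasurable
    · exact Eventually.of_forall fun u => hbdd _ ω
  have hprod : ∀ a b : ℝ, Integrable (Function.uncurry fun u ω => A f (X u.toNNReal ω))
      ((volume.restrict (Set.uIoc a b)).prod P) := by
    intro a b
    have : IsFiniteMeasure ((volume : Measure ℝ).restrict (Set.uIoc a b)) := by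
      rw [Set.uIoc]; infer_instance
    refine Integrable.of_bound (C := ∑ x ∈ s, ‖A f x‖) hjm.aestronglyMeasurable ?_
    exact Eventually.of_forall fun u => hbdd _ _
  have hfint : ∀ t, Integrable (fun ω => f (X t ω)) P := by
    intro t
    simp_rw [hfin f hf.toFinset (fun x _ hx => by simpa using hx) t]
    exact integrable_finsetSum _ fun x _ =>
      ((integrable_const _).indicator (hpre t x)).const_mul _
  have hIint : ∀ a b : ℝ, Integrable (fun ω => ∫ u in a..b, A f (X u.toNNReal ω)) P := by
    intro a b
    simp_rw [intervalIntegral.intervalIntegral_eq_integral_uIoc]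
    exact Integrable.smul (if a ≤ b then 1 else -1 : ℝ) (hprod a b).integral_prod_right
  -- On a window of fixed length one, the right side tends to 0 and the left side to the stationary
  -- mean of `A f`.
  have hkey : ∀ t : ℝ≥0, ∫ u in (t : ℝ)..(t + 1), (∫ ω, A f (X u.toNNReal ω) ∂P)
      = (∫ ω, f (X (t + 1) ω) ∂P) - ∫ ω, f (X t ω) ∂P := by
    intro t
    rw [intervalIntegral_integral_swap (hprod _ _)]
    have h1 := hmart.setIntegral_eq (i := t) (j := t + 1) (by simp) MeasurableSet.univ
    simp only [Measure.restrict_univ] at h1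
    rw [integral_sub (hfint t) (hIint _ _), integral_sub (hfint _) (hIint _ _)] at h1
    have h2 : ∀ ω, ∫ u in (t : ℝ)..(t + 1), A f (X u.toNNReal ω)
        = (∫ u in (0 : ℝ)..((t + 1 : ℝ≥0) : ℝ), A f (X u.toNNReal ω))
          - ∫ u in (0 : ℝ)..(t : ℝ), A f (X u.toNNReal ω) := by
      intro ω
      rw [intervalIntegral.integral_interval_sub_left (hint _ _ _) (hint _ _ _)]
      simp
    simp_rw [h2]
    rw [integral_sub (hIint _ _) (hIint _ _)]
    linarith
  set c := ∑ x ∈ s, A f x * π.real {x} with hc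
  have hzero : Tendsto (fun t : ℝ≥0 => (∫ ω, f (X (t + 1) ω) ∂P) - ∫ ω, f (X t ω) ∂P) atTop
      (𝓝 0) := by
    have h1 := hlim f hf.toFinset (fun x _ hx => by simpa using hx)
    have h2 : Tendsto (fun t : ℝ≥0 => t + 1) atTop atTop :=
      tendsto_atTop_mono (fun t => le_self_add) tendsto_id
    have h3 := (h1.comp h2).sub h1
    rw [sub_self] at h3
    exact h3
  have hconv : Tendsto (fun t : ℝ≥0 => (∫ ω, f (X (t + 1) ω) ∂P) - ∫ ω, f (X t ω) ∂P) atTop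
      (𝓝 c) := by
    rw [Metric.tendsto_atTop]
    intro ε hε
    obtain ⟨T, hT⟩ := Metric.tendsto_atTop.1 (hlim (A f) s hs) (ε / 2) (by positivity)
    refine ⟨T, fun t ht => ?_⟩
    rw [← hkey t, Real.dist_eq]
    have hφ : IntervalIntegrable (fun u : ℝ => ∫ ω, A f (X u.toNNReal ω) ∂P) volume
        (t : ℝ) (t + 1) := by
      rw [intervalIntegrable_iff]
      exact (hprod _ _).integral_prod_left
    have h1 : (∫ u in (t : ℝ)..(t + 1), (∫ ω, A f (X u.toNNReal ω) ∂P)) - c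
        = ∫ u in (t : ℝ)..(t + 1), ((∫ ω, A f (X u.toNNReal ω) ∂P) - c) := by
      rw [intervalIntegral.integral_sub hφ (by simp)]
      simp
    rw [h1]
    have h2 := intervalIntegral.norm_integral_le_of_norm_le_const (C := ε / 2) (a := (t : ℝ))
      (b := t + 1) (f := fun u => (∫ ω, A f (X u.toNNReal ω) ∂P) - c) (by
        intro u hu
        rw [Set.uIoc_of_le (by simp)] at hu
        have := hT u.toNNReal (ht.trans (by
          rw [← NNReal.coe_le_coe, Real.coe_toNNReal u (t.coe_nonneg.trans hu.1.le)]
          exact hu.1.le))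
        rw [Real.dist_eq] at this
        exact this.le)
    rw [Real.norm_eq_abs] at h2
    have h3 : |(t : ℝ) + 1 - t| = 1 := by simp
    rw [h3] at h2
    linarith
  exact tendsto_nhds_unique hconv hzero

theorem IsSteadyStateLaw.measureReal_eq_zero [MeasurableSpace S]
    {π : Measure S} (hπ : IsSteadyStateLaw P X π)
    (h : IsMarkovJumpProcess A E P X) {x : S} (hx : x ∉ E) : π.real {x} = 0 := by
  have h1 : ∀ t, X t ⁻¹' {x} = ∅ := fun t => by
    ext ω
    simp only [Set.mem_preimage, Set.mem_singleton_iff, Set.mem_empty_iff_false, iff_false]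
    exact fun h2 => hx (h2 ▸ h.mem_states t ω)
  have h2 := hπ.tendsto x
  simp only [h1, measure_empty] at h2
  simp [measureReal_def, tendsto_nhds_unique h2 tendsto_const_nhds]

end Stationarity

/-! ### Global balance equations of the station -/

namespace Charging

/-- The arrival rate when `q` vehicles are present. -/
noncomputable def arrivalRate (lam : ℝ) (K : ℕ∞) (q : ℕ) : ℝ := if (q : ℕ∞) < K then lam else 0

/-- The stationary flux of arrivals that lead to the state `(q, z)`. -/
noncomputable def arrivalFlux (a : ℕ → ℝ) (p : ℕ → ℕ → ℝ) : ℕ → ℕ → ℝ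
  | q + 1, z + 1 => a q * p q z
  | 0, _ => 0
  | _ + 1, 0 => 0

/-- Nonnegative weights on the states of the charging station that solve the global balance
equations. -/
structure IsBalanced (lam μ ν : ℝ) (K : ℕ∞) (M : ℝ) (p : ℕ → ℕ → ℝ) : Prop where
  nonneg : ∀ q z, 0 ≤ p q z
  eq_zero : ∀ q z, (q, z) ∉ states K → p q z = 0
  balance : ∀ q z, p q z * (arrivalRate lam K q + (μ * min (z : ℝ) M + ν * z) + ν * (q - z))
    = arrivalFlux (arrivalRate lam K) p q z + μ * min ((z + 1 : ℕ) : ℝ) M * p q (z + 1)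
      + ν * (z + 1) * p (q + 1) (z + 1) + ν * (q + 1 - z) * p (q + 1) z

/-- Stationarity tested on the indicator of `(q, z)`: each kind of transition enters this state from
at most one predecessor of positive rate and mass. -/
theorem isBalanced_of_isSteadyStateLaw {Ω : Type*} [MeasurableSpace Ω] {lam μ ν : ℝ} {K : ℕ∞}
    {M : ℝ} (hM : 0 < M) {P : Measure Ω} [IsProbabilityMeasure P] {Y : ℝ≥0 → Ω → ℕ × ℕ}
    (hY : IsStation lam μ ν K M P Y) {π : Measure (ℕ × ℕ)} (hπ : IsSteadyStateLaw P Y π) :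
    IsBalanced lam μ ν K M (fun q z => π.real {(q, z)}) := by
  have hz : ∀ q z, (q, z) ∉ states K → π.real {(q, z)} = 0 := fun q z h =>
    hπ.measureReal_eq_zero hY h
  refine ⟨fun _ _ => measureReal_nonneg, hz, fun q z => ?_⟩
  by_cases hzq : z ≤ q
  swap
  · have h0 : ∀ i j, i < j → π.real {(i, j)} = 0 := fun i j h =>
      hz i j (by simp only [states, Set.mem_ofPred_eq]; omega)
    have h1 : arrivalFlux (arrivalRate lam K) (fun q z => π.real {(q, z)}) q z = 0 := by
      rcases q with _ | q
      · rfl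
      · rcases z with _ | z
        · rfl
        · simp [arrivalFlux, h0 q z (by omega)]
    -- The diagonal state `(q + 1, q + 1)` may carry mass, but its coefficient is zero.
    have h2 : ν * ((q : ℝ) + 1 - z) * π.real {(q + 1, z)} = 0 := by
      rcases eq_or_ne z (q + 1) with h | h
      · subst h; push_cast; ring
      · rw [h0 _ _ (by omega), mul_zero]
    rw [h1, h2, h0 q z (by omega), h0 q (z + 1) (by omega), h0 (q + 1) (z + 1) (by omega)]
    ring
  let f : ℕ × ℕ → ℝ := fun x => if x = (q, z) then 1 else 0
  let s : Finset (ℕ × ℕ) := Finset.range (q + 2) ×ˢ Finset.range (z + 2)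
  have hf : (Function.support f).Finite := by
    refine (Set.finite_singleton (q, z)).subset fun x hx => ?_
    by_contra h
    exact hx (if_neg h)
  have hs : ∀ x ∈ states K, x ∉ s → generator lam μ ν K M f x = 0 := by
    rintro ⟨i, j⟩ - hx
    have hx' : ¬ (i < q + 2 ∧ j < z + 2) := by simpa [s] using hx
    simp only [generator, f, Prod.mk.injEq]
    rw [if_neg (c := i = q ∧ j = z) (by omega), if_neg (c := i + 1 = q ∧ j + 1 = z) (by omega),
      if_neg (c := i = q ∧ j - 1 = z) (by omega), if_neg (c := i - 1 = q ∧ j - 1 = z) (by omega),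
      if_neg (c := i - 1 = q ∧ j = z) (by omega)]
    simp
  have key := hπ.sum_generator_eq_zero hY hf s hs
  have hsum : ∀ (T : ℕ × ℕ → ℕ × ℕ) (r : ℕ × ℕ → ℝ) (x₀ : ℕ × ℕ), x₀ ∈ s → T x₀ = (q, z) →
      (∀ x, T x = (q, z) → x ≠ x₀ → r x * π.real {x} = 0) →
      ∑ x ∈ s, r x * f (T x) * π.real {x} = r x₀ * π.real {x₀} := by
    intro T r x₀ h1 h2 h3
    rw [Finset.sum_eq_single x₀]
    · simp [f, h2]
    · intro x _ hx
      by_cases h : T x = (q, z)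
      · simpa [f, h] using h3 x h hx
      · simp [f, h]
    · exact fun h => absurd h1 h
  have hmin : min (0 : ℝ) M = 0 := min_eq_left hM.le
  have e0 := hsum id (fun x => (if (x.1 : ℕ∞) < K then lam else 0) + μ * min (x.2 : ℝ) M
    + ν * x.2 + ν * ((x.1 : ℝ) - x.2)) (q, z) (by simp [s]) rfl (fun x h h' => absurd h h')
  have e1 : ∑ x ∈ s, (if (x.1 : ℕ∞) < K then lam else 0) * f (x.1 + 1, x.2 + 1) * π.real {x}
      = arrivalFlux (arrivalRate lam K) (fun q z => π.real {(q, z)}) q z := by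
    have : ∀ i j, (∀ i' j', ¬ (q = i' + 1 ∧ z = j' + 1)) → f (i + 1, j + 1) = 0 := by
      intro i j h
      refine if_neg fun h' => h i j ?_
      simp only [Prod.mk.injEq] at h'
      omega
    rcases q with _ | q
    · exact Finset.sum_eq_zero fun x _ => by rw [this _ _ (by omega)]; ring
    · rcases z with _ | z
      · exact Finset.sum_eq_zero fun x _ => by rw [this _ _ (by omega)]; ring
      · refine hsum (fun x => (x.1 + 1, x.2 + 1)) (fun x => if (x.1 : ℕ∞) < K then lam else 0)
          (q, z) (by simp [s]; omega) rfl ?_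
        rintro ⟨i, j⟩ h h'
        simp only [Prod.mk.injEq, ne_eq] at h h'
        omega
  -- Here and in the next two sums, truncated subtraction creates spurious predecessors; they have
  -- zero rate or lie outside the state space.
  have e2 := hsum (fun x => (x.1, x.2 - 1)) (fun x => μ * min (x.2 : ℝ) M) (q, z + 1)
    (by simp [s]) rfl (by
      rintro ⟨i, j⟩ h h'
      simp only [Prod.mk.injEq, ne_eq] at h h'
      obtain rfl : j = 0 := by omega
      simp [hmin])
  have e3 := hsum (fun x => (x.1 - 1, x.2 - 1)) (fun x => ν * (x.2 : ℝ)) (q + 1, z + 1)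
    (by simp [s]) rfl (by
      rintro ⟨i, j⟩ h h'
      simp only [Prod.mk.injEq, ne_eq] at h h'
      rcases Nat.eq_zero_or_pos j with rfl | hj
      · simp
      · rw [hz i j (by simp only [states, Set.mem_ofPred_eq]; omega), mul_zero])
  have e4 := hsum (fun x => (x.1 - 1, x.2)) (fun x => ν * ((x.1 : ℝ) - x.2)) (q + 1, z)
    (by simp [s]) rfl (by
      rintro ⟨i, j⟩ h h'
      simp only [Prod.mk.injEq, ne_eq] at h h'
      obtain rfl : i = 0 := by omega
      obtain rfl : j = 0 := by omega
      simp)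
  have hsplit : ∑ x ∈ s, generator lam μ ν K M f x * π.real {x}
      = (∑ x ∈ s, (if (x.1 : ℕ∞) < K then lam else 0) * f (x.1 + 1, x.2 + 1) * π.real {x})
        + (∑ x ∈ s, μ * min (x.2 : ℝ) M * f (x.1, x.2 - 1) * π.real {x})
        + (∑ x ∈ s, ν * (x.2 : ℝ) * f (x.1 - 1, x.2 - 1) * π.real {x})
        + (∑ x ∈ s, ν * ((x.1 : ℝ) - x.2) * f (x.1 - 1, x.2) * π.real {x})
        - ∑ x ∈ s, ((if (x.1 : ℕ∞) < K then lam else 0) + μ * min (x.2 : ℝ) M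
            + ν * x.2 + ν * ((x.1 : ℝ) - x.2)) * f x * π.real {x} := by
    rw [← Finset.sum_add_distrib, ← Finset.sum_add_distrib, ← Finset.sum_add_distrib,
      ← Finset.sum_sub_distrib]
    refine Finset.sum_congr rfl fun x _ => ?_
    simp only [generator]
    ring
  simp only [id] at e0
  rw [hsplit, e1, e2, e3, e4, e0] at key
  simp only [arrivalRate] at key ⊢
  push_cast at key ⊢
  linarith

namespace IsBalanced

variable {lam μ ν : ℝ} {K : ℕ∞} {M : ℝ} {p : ℕ → ℕ → ℝ}

theorem eq_zero_of_lt (h : IsBalanced lam μ ν K M p) {q z : ℕ} (hz : q < z) : p q z = 0 :=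
  h.eq_zero q z (by simp only [states, Set.mem_ofPred_eq]; omega)

theorem eq_zero_of_capacity_lt (h : IsBalanced lam μ ν K M p) {q : ℕ} (z : ℕ) (hq : K < q) :
    p q z = 0 :=
  h.eq_zero q z (fun h' => absurd h'.2 (not_le.2 hq))

end IsBalanced

/-! ### Net fluxes and their superharmonicity -/

/-- The net downward flux through the level `z` of the number of uncharged vehicles, restricted
to at most `q` vehicles in total. -/
noncomputable def netFlux (lam μ ν : ℝ) (K : ℕ∞) (M : ℝ) (p : ℕ → ℕ → ℝ) (q z : ℕ) : ℝ :=
  ∑ i ∈ Finset.range (q + 1), ((μ * min (z : ℝ) M + ν * z) * p i z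
    - arrivalFlux (arrivalRate lam K) p i z)

namespace IsBalanced

variable {lam μ ν : ℝ} {K : ℕ∞} {M : ℝ} {p : ℕ → ℕ → ℝ}

theorem netFlux_succ (q z : ℕ) : netFlux lam μ ν K M p (q + 1) (z + 1)
    = netFlux lam μ ν K M p q (z + 1) + ((μ * min ((z + 1 : ℕ) : ℝ) M + ν * (z + 1)) *
      p (q + 1) (z + 1) - arrivalRate lam K q * p q z) := by
  rw [netFlux, Finset.sum_range_succ, ← netFlux]
  simp [arrivalFlux]

theorem netFlux_zero_right (hM : 0 < M) (q : ℕ) : netFlux lam μ ν K M p q 0 = 0 := by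
  refine Finset.sum_eq_zero fun i _ => ?_
  have : arrivalFlux (arrivalRate lam K) p i 0 = 0 := by cases i <;> rfl
  simp [this, hM.le]

theorem netFlux_eq_zero_of_lt (h : IsBalanced lam μ ν K M p) {q z : ℕ} (hz : q < z) :
    netFlux lam μ ν K M p q z = 0 := by
  refine Finset.sum_eq_zero fun i hi => ?_
  have hi' : i < z := by have := Finset.mem_range.1 hi; omega
  have h1 : arrivalFlux (arrivalRate lam K) p i z = 0 := by
    rcases i with _ | i
    · rfl
    · rcases z with _ | z
      · rfl
      · simp [arrivalFlux, h.eq_zero_of_lt (show i < z by omega)]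
  rw [h1, h.eq_zero_of_lt hi', mul_zero, sub_zero]

/-- Balance of the set of states with `z` uncharged and at most `q` vehicles in total. -/
theorem netFlux_sub (h : IsBalanced lam μ ν K M p) (hM : 0 < M) (q z : ℕ) :
    netFlux lam μ ν K M p q z - netFlux lam μ ν K M p q (z + 1)
      = ν * (z + 1) * p (q + 1) (z + 1) + ν * (q + 1 - z) * p (q + 1) z
        - arrivalRate lam K q * p q z := by
  induction q with
  | zero =>
    have h1 := h.balance 0 z
    have h2 : (z : ℝ) * p 0 z = 0 := by
      rcases Nat.eq_zero_or_pos z with rfl | hz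
      · simp
      · rw [h.eq_zero_of_lt hz, mul_zero]
    have h3 : p 0 (z + 1) = 0 := h.eq_zero_of_lt (by omega)
    simp only [netFlux, zero_add, Finset.range_one, Finset.sum_singleton, arrivalFlux, h3] at h1 ⊢
    push_cast at h1 ⊢
    linear_combination h1 + ν * h2
  | succ q ih =>
    have h1 := h.balance (q + 1) z
    rcases z with _ | z
    · rw [netFlux_zero_right hM] at ih ⊢
      rw [netFlux_succ]
      simp only [arrivalFlux, Nat.cast_zero, min_eq_left hM.le] at h1 ih ⊢
      push_cast at h1 ih ⊢
      linear_combination h1 + ih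
    · rw [netFlux_succ, netFlux_succ]
      simp only [arrivalFlux] at h1 ih ⊢
      push_cast at h1 ih ⊢
      linear_combination h1 + ih

/-- The net flux is superharmonic for a nearest-neighbour operator. -/
theorem netFlux_superharmonic (h : IsBalanced lam μ ν K M p) (hM : 0 < M) (hμ : 0 < μ)
    (hν : 0 < ν) (q z : ℕ) (hq : ((q + 1 : ℕ) : ℕ∞) < K) :
    lam * (netFlux lam μ ν K M p q z - netFlux lam μ ν K M p (q + 1) (z + 1))
      + ν * (z + 1) * (netFlux lam μ ν K M p (q + 2) (z + 2)
          - netFlux lam μ ν K M p (q + 1) (z + 1))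
      + μ * min ((z + 1 : ℕ) : ℝ) M * (netFlux lam μ ν K M p (q + 1) (z + 2)
          - netFlux lam μ ν K M p (q + 1) (z + 1))
      + ν * (q - z + 1) * (netFlux lam μ ν K M p (q + 2) (z + 1)
          - netFlux lam μ ν K M p (q + 1) (z + 1)) ≤ 0 := by
  have a1 : arrivalRate lam K (q + 1) = lam := if_pos hq
  have a0 : arrivalRate lam K q = lam := if_pos (lt_of_le_of_lt (by norm_cast; omega) hq)
  have i1 := h.netFlux_sub hM q z
  have i2 := h.netFlux_sub hM (q + 1) (z + 1)
  have u1 := netFlux_succ (lam := lam) (μ := μ) (ν := ν) (K := K) (M := M) (p := p) q z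
  have u2 := netFlux_succ (lam := lam) (μ := μ) (ν := ν) (K := K) (M := M) (p := p) (q + 1) z
  have u3 := netFlux_succ (lam := lam) (μ := μ) (ν := ν) (K := K) (M := M) (p := p)
    (q + 1) (z + 1)
  rw [a0] at i1 u1
  rw [a1] at i2 u2 u3
  simp only [add_assoc, Nat.reduceAdd] at i2 u2 u3
  -- Monotonicity of min(z,M)/z is the sole source of the sign.
  have hmin : ((z : ℝ) + 1) * min ((z : ℝ) + 2) M ≤ ((z : ℝ) + 2) * min ((z : ℝ) + 1) M := by
    have hz : (0 : ℝ) ≤ z := z.cast_nonneg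
    rcases le_total ((z : ℝ) + 1) M with h1 | h1
    · rw [min_eq_left h1]
      nlinarith [min_le_left ((z : ℝ) + 2) M]
    · rw [min_eq_right h1]
      nlinarith [min_le_right ((z : ℝ) + 2) M]
  have hpos := h.nonneg (q + 2) (z + 2)
  have hfin : 0 ≤ ν * μ * (((z : ℝ) + 2) * min ((z : ℝ) + 1) M
      - ((z : ℝ) + 1) * min ((z : ℝ) + 2) M) * p (q + 2) (z + 2) :=
    mul_nonneg (mul_nonneg (by positivity) (by linarith)) hpos
  push_cast at *
  have e1 : ((z : ℝ) + 1 + 1) = z + 2 := by ring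
  have e2 : ((q : ℝ) + 1 + 1) = q + 2 := by ring
  simp only [e1, e2] at *
  generalize netFlux lam μ ν K M p q z = Uqz at *
  generalize netFlux lam μ ν K M p (q + 1) (z + 1) = U11 at *
  generalize netFlux lam μ ν K M p (q + 2) (z + 2) = U22 at *
  generalize netFlux lam μ ν K M p (q + 1) (z + 2) = U12 at *
  generalize netFlux lam μ ν K M p (q + 2) (z + 1) = U21 at *
  generalize netFlux lam μ ν K M p q (z + 1) = U01 at *
  generalize min ((z : ℝ) + 1) M = m1 at *
  generalize min ((z : ℝ) + 2) M = m2 at *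
  -- The operator jumps opposite to the station. The cut equations eliminate every weight except `p
  -- (q + 2) (z + 2)`.
  have : lam * (Uqz - U11) + ν * (z + 1) * (U22 - U11) + μ * m1 * (U12 - U11)
      + ν * (q - z + 1) * (U21 - U11)
      = - (ν * μ * (((z : ℝ) + 2) * m1 - ((z : ℝ) + 1) * m2) * p (q + 2) (z + 2)) := by
    linear_combination lam * i1 - lam * u1 + ν * (q - z + 1) * u2 + ν * (z + 1) * u3
      - (μ * m1 + ν * (z + 1)) * i2
  linarith

end IsBalanced
end Charging

/-! ### Integrals as sums over a countable space, and marginals -/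

theorem hasSum_measureReal_mul_integral {S : Type*} [Countable S] [MeasurableSpace S]
    [MeasurableSingletonClass S] {π : Measure S} {f : S → ℝ} (hf : Integrable f π) :
    HasSum (fun x => π.real {x} * f x) (∫ x, f x ∂π) := by
  have h := hf
  rw [← Measure.sum_smul_dirac π] at h
  have h1 := hasSum_integral_measure h
  rw [Measure.sum_smul_dirac π] at h1
  simpa [integral_smul_measure, measureReal_def] using h1

theorem integrable_of_summable_measureReal_mul {S : Type*} [Countable S] [MeasurableSpace S]
    [MeasurableSingletonClass S] {π : Measure S} [IsFiniteMeasure π] {f : S → ℝ}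
    (hf : Summable (fun x => π.real {x} * ‖f x‖)) : Integrable f π := by
  rw [← Measure.sum_smul_dirac π]
  exact integrable_sum_dirac (fun x => measure_ne_top π _) hf

theorem HasSum.marginal_fst {p : ℕ → ℕ → ℝ} (hp : Summable fun x : ℕ × ℕ => p x.1 x.2)
    {φ : ℕ → ℝ} {I : ℝ} (h : HasSum (fun x : ℕ × ℕ => p x.1 x.2 * φ x.1) I) :
    HasSum (fun q => (∑' z, p q z) * φ q) I :=
  h.prod_fiberwise fun q => (hp.prod_factor q).hasSum.mul_right (φ q)

theorem HasSum.marginal_snd {p : ℕ → ℕ → ℝ} (hp : Summable fun x : ℕ × ℕ => p x.1 x.2)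
    {φ : ℕ → ℝ} {I : ℝ} (h : HasSum (fun x : ℕ × ℕ => p x.1 x.2 * φ x.2) I) :
    HasSum (fun z => (∑' q, p q z) * φ z) I :=
  HasSum.marginal_fst (p := fun z q => p q z) ((Equiv.prodComm ℕ ℕ).summable_iff.2 hp)
    ((Equiv.prodComm ℕ ℕ).hasSum_iff.2 h)

/-! ### Marginal recursions and the flow identity -/

namespace Charging

theorem arrivalRate_nonneg {lam : ℝ} (hlam : 0 ≤ lam) (K : ℕ∞) (q : ℕ) :
    0 ≤ arrivalRate lam K q := by
  unfold arrivalRate; split_ifs <;> simp [hlam]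

theorem arrivalRate_le {lam : ℝ} (hlam : 0 ≤ lam) (K : ℕ∞) (q : ℕ) :
    arrivalRate lam K q ≤ lam := by
  unfold arrivalRate; split_ifs <;> simp [hlam]

namespace IsBalanced

variable {lam μ ν : ℝ} {K : ℕ∞} {M : ℝ} {p : ℕ → ℕ → ℝ}

theorem tsum_row (h : IsBalanced lam μ ν K M p) (q : ℕ) :
    ∑' z, p q z = ∑ z ∈ Finset.range (q + 1), p q z :=
  tsum_eq_sum fun z hz => h.eq_zero_of_lt (by simpa [Nat.lt_succ_iff] using hz)

theorem sum_netFlux_sub (h : IsBalanced lam μ ν K M p) (hM : 0 < M) (q n : ℕ) :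
    - netFlux lam μ ν K M p q n = ∑ j ∈ Finset.range n, (ν * (j + 1) * p (q + 1) (j + 1)
      + ν * (q + 1 - j) * p (q + 1) j - arrivalRate lam K q * p q j) := by
  have := Finset.sum_range_sub' (fun j => netFlux lam μ ν K M p q j) n
  rw [netFlux_zero_right hM, zero_sub] at this
  rw [← this]
  exact Finset.sum_congr rfl fun j _ => h.netFlux_sub hM q j

/-- The number of vehicles is a birth-death process, hence in detailed balance. -/
theorem row_succ (h : IsBalanced lam μ ν K M p) (hM : 0 < M) (q : ℕ) :
    ν * (q + 1) * ∑' z, p (q + 1) z = arrivalRate lam K q * ∑' z, p q z := by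
  -- Beyond level `q` the net flux vanishes, so the full sum over levels is the balance of {Q ≤ q}.
  have h1 := h.sum_netFlux_sub hM q (q + 2)
  rw [h.netFlux_eq_zero_of_lt (by omega), Finset.sum_sub_distrib, Finset.sum_add_distrib] at h1
  have h2 : ∑ j ∈ Finset.range (q + 2), ν * ((j : ℝ) + 1) * p (q + 1) (j + 1)
      = ∑ j ∈ Finset.range (q + 2), ν * (j : ℝ) * p (q + 1) j := by
    have h3 := Finset.sum_range_succ' (fun j : ℕ => ν * (j : ℝ) * p (q + 1) j) (q + 2)
    rw [Finset.sum_range_succ, h.eq_zero_of_lt (show q + 1 < q + 2 by omega)] at h3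
    push_cast at h3
    linarith
  rw [h2, ← Finset.sum_add_distrib, ← Finset.mul_sum, Finset.sum_range_succ (fun j => p q j),
    h.eq_zero_of_lt (show q < q + 1 by omega), add_zero, ← h.tsum_row] at h1
  have h4 : ∑ j ∈ Finset.range (q + 2), (ν * (j : ℝ) * p (q + 1) j
      + ν * ((q : ℝ) + 1 - j) * p (q + 1) j) = ν * (q + 1) * ∑' z, p (q + 1) z := by
    rw [h.tsum_row, Finset.mul_sum]
    exact Finset.sum_congr rfl fun j _ => by ring
  linarith

/-- The negated flux is a partial sum of terms bounded below by minus the arrival flow, and the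
complete sum is zero; bounding the partial sum and its complement from below gives both signs.
Consequently the flux vanishes at capacity and tends to zero as `q` grows. -/
theorem abs_netFlux_le (h : IsBalanced lam μ ν K M p) (hM : 0 < M) (hν : 0 < ν) (hlam : 0 ≤ lam)
    (q z : ℕ) :
    |netFlux lam μ ν K M p q z| ≤ arrivalRate lam K q * ∑' z, p q z := by
  have ha := arrivalRate_nonneg hlam K q
  have hrow : 0 ≤ ∑' z, p q z := tsum_nonneg fun z => h.nonneg q z
  rcases lt_or_ge q z with hz | hz
  · rw [h.netFlux_eq_zero_of_lt hz, abs_zero]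
    exact mul_nonneg ha hrow
  let t : ℕ → ℝ := fun j => ν * (j + 1) * p (q + 1) (j + 1)
      + ν * (q + 1 - j) * p (q + 1) j - arrivalRate lam K q * p q j
  have ht : ∀ j, - (arrivalRate lam K q * p q j) ≤ t j := by
    intro j
    have h1 : 0 ≤ ν * ((j : ℝ) + 1) * p (q + 1) (j + 1) :=
      mul_nonneg (by positivity) (h.nonneg _ _)
    have h2 : 0 ≤ ν * ((q : ℝ) + 1 - j) * p (q + 1) j := by
      rcases le_or_gt j (q + 1) with hj | hj
      · have : (j : ℝ) ≤ q + 1 := by exact_mod_cast hj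
        exact mul_nonneg (mul_nonneg hν.le (by linarith)) (h.nonneg _ _)
      · rw [h.eq_zero_of_lt hj, mul_zero]
    simp only [t]
    linarith
  have hsub : ∀ s ⊆ Finset.range (q + 1), - (arrivalRate lam K q * ∑' z, p q z) ≤ ∑ j ∈ s, t j := by
    intro s hs
    rw [h.tsum_row]
    calc - (arrivalRate lam K q * ∑ z ∈ Finset.range (q + 1), p q z)
        ≤ - (arrivalRate lam K q * ∑ z ∈ s, p q z) := by
          refine neg_le_neg (mul_le_mul_of_nonneg_left ?_ ha)
          exact Finset.sum_le_sum_of_subset_of_nonneg hs fun _ _ _ => h.nonneg _ _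
      _ = ∑ j ∈ s, - (arrivalRate lam K q * p q j) := by
          rw [Finset.mul_sum, Finset.sum_neg_distrib]
      _ ≤ _ := Finset.sum_le_sum fun j _ => ht j
  have h1 := h.sum_netFlux_sub hM q z
  have h2 := h.sum_netFlux_sub hM q (q + 1)
  rw [h.netFlux_eq_zero_of_lt (by omega), ← Finset.sum_range_add_sum_Ico _ (show z ≤ q + 1 by omega)]
    at h2
  have h3 := hsub (Finset.range z) (Finset.range_mono (by omega))
  have h4 := hsub (Finset.Ico z (q + 1)) (fun j hj => by
    rw [Finset.mem_range]; exact (Finset.mem_Ico.1 hj).2)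
  simp only [t] at h3 h4
  rw [abs_le]
  constructor <;> linarith

/-- Detailed balance of the rows bounds `q + 1` times row `q + 1` by `lam / ν` times row `q`. -/
theorem summable_fst (h : IsBalanced lam μ ν K M p) (hM : 0 < M) (hν : 0 < ν) (hlam : 0 ≤ lam)
    (hp : Summable fun x : ℕ × ℕ => p x.1 x.2) :
    Summable fun x : ℕ × ℕ => p x.1 x.2 * x.1 := by
  rw [summable_prod_of_nonneg (fun x => mul_nonneg (h.nonneg _ _) (Nat.cast_nonneg _))]
  refine ⟨fun q => Summable.mul_right (f := fun z => p q z) (q : ℝ) (hp.prod_factor q), ?_⟩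
  simp_rw [tsum_mul_right]
  rw [← summable_nat_add_iff 1]
  refine Summable.of_nonneg_of_le (f := fun q => lam / ν * ∑' z, p q z)
    (fun q => mul_nonneg (tsum_nonneg fun _ => h.nonneg _ _) (Nat.cast_nonneg _)) (fun q => ?_)
    (hp.prod.mul_left _)
  have h1 := h.row_succ hM q
  have h2 : arrivalRate lam K q * ∑' z, p q z ≤ lam * ∑' z, p q z :=
    mul_le_mul_of_nonneg_right (arrivalRate_le hlam K q) (tsum_nonneg fun _ => h.nonneg _ _)
  rw [div_mul_eq_mul_div, le_div_iff₀ hν]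
  push_cast
  linarith

/-- Balance of the set of states with more than `z` uncharged vehicles. -/
theorem hasSum_column (h : IsBalanced lam μ ν K M p) (hM : 0 < M) (hν : 0 < ν) (hlam : 0 ≤ lam)
    (hp : Summable fun x : ℕ × ℕ => p x.1 x.2) (z : ℕ) :
    HasSum (fun q => arrivalRate lam K q * p q z)
      ((μ * min ((z + 1 : ℕ) : ℝ) M + ν * (z + 1)) * ∑' q, p q (z + 1)) := by
  rw [hasSum_iff_tendsto_nat_of_nonneg
    (fun q => mul_nonneg (arrivalRate_nonneg hlam K q) (h.nonneg q z))]
  have hcol : Summable fun q => p q (z + 1) :=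
    ((Equiv.prodComm ℕ ℕ).summable_iff.2 hp).prod_factor (z + 1)
  have h1 : Tendsto (fun q => netFlux lam μ ν K M p q (z + 1)) atTop (𝓝 0) := by
    refine squeeze_zero_norm (a := fun q => lam * ∑' z, p q z) (fun q => ?_) ?_
    · rw [Real.norm_eq_abs]
      exact (h.abs_netFlux_le hM hν hlam q _).trans (mul_le_mul_of_nonneg_right
        (arrivalRate_le hlam K q) (tsum_nonneg fun _ => h.nonneg _ _))
    · simpa using hp.prod.tendsto_atTop_zero.const_mul lam
  have h2 : Tendsto (fun q => ∑ i ∈ Finset.range (q + 1), p i (z + 1)) atTop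
      (𝓝 (∑' q, p q (z + 1))) := hcol.hasSum.tendsto_sum_nat.comp (tendsto_add_atTop_nat 1)
  have h3 := (h2.const_mul (μ * min ((z + 1 : ℕ) : ℝ) M + ν * (z + 1))).sub h1
  rw [sub_zero] at h3
  refine h3.congr fun q => ?_
  rw [netFlux, Finset.sum_sub_distrib, ← Finset.mul_sum, Finset.sum_range_succ' (fun i =>
    arrivalFlux (arrivalRate lam K) p i (z + 1))]
  simp only [arrivalFlux]
  push_cast
  ring

/-- Blocking can only lower the arrival rate below `lam`; without blocking, equality holds. -/
theorem column_succ_le (h : IsBalanced lam μ ν K M p) (hM : 0 < M) (hν : 0 < ν) (hlam : 0 ≤ lam)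
    (hp : Summable fun x : ℕ × ℕ => p x.1 x.2) (z : ℕ) :
    (μ * min ((z + 1 : ℕ) : ℝ) M + ν * (z + 1)) * ∑' q, p q (z + 1) ≤ lam * ∑' q, p q z := by
  have hcol : Summable fun q => p q z :=
    ((Equiv.prodComm ℕ ℕ).summable_iff.2 hp).prod_factor z
  exact hasSum_le (fun q => mul_le_mul_of_nonneg_right (arrivalRate_le hlam K q) (h.nonneg q z))
    (h.hasSum_column hM hν hlam hp z) (hcol.hasSum.mul_left lam)

theorem column_succ_of_top (h : IsBalanced lam μ ν ⊤ M p) (hM : 0 < M) (hν : 0 < ν)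
    (hlam : 0 ≤ lam) (hp : Summable fun x : ℕ × ℕ => p x.1 x.2) (z : ℕ) :
    (μ * min ((z + 1 : ℕ) : ℝ) M + ν * (z + 1)) * ∑' q, p q (z + 1) = lam * ∑' q, p q z := by
  have h1 := h.hasSum_column hM hν hlam hp z
  rw [← h1.tsum_eq, ← tsum_mul_left]
  exact tsum_congr fun q => by simp [arrivalRate]

/-- Otherwise the row recursion would annihilate every row, against total mass one. -/
theorem row_zero_pos (h : IsBalanced lam μ ν K M p) (hM : 0 < M) (hν : 0 < ν)
    (hp : HasSum (fun x : ℕ × ℕ => p x.1 x.2) 1) : 0 < ∑' z, p 0 z := by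
  refine lt_of_le_of_ne (tsum_nonneg fun _ => h.nonneg _ _) fun h0 => ?_
  have h1 : ∀ q, ∑' z, p q z = 0 := by
    intro q
    induction q with
    | zero => exact h0.symm
    | succ q ih =>
      have h2 := h.row_succ hM q
      rw [ih, mul_zero] at h2
      exact (mul_eq_zero.1 h2).resolve_left (by positivity)
  have h2 := hp.prod_fiberwise fun q => (hp.summable.prod_factor q).hasSum
  simp only [h1] at h2
  exact zero_ne_one (hasSum_zero.unique h2)

/-- The law of the number of vehicles does not depend on the power. -/
theorem row_eq (h : IsBalanced lam μ ν K M p) (hM : 0 < M) (hν : 0 < ν)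
    (hp : HasSum (fun x : ℕ × ℕ => p x.1 x.2) 1) {M' : ℝ} {p' : ℕ → ℕ → ℝ}
    (h' : IsBalanced lam μ ν K M' p') (hM' : 0 < M')
    (hp' : HasSum (fun x : ℕ × ℕ => p' x.1 x.2) 1) (q : ℕ) : ∑' z, p q z = ∑' z, p' q z := by
  have h1 : ∀ q, (∑' z, p' 0 z) * ∑' z, p q z = (∑' z, p 0 z) * ∑' z, p' q z := by
    intro q
    induction q with
    | zero => ring
    | succ q ih =>
      have e1 := h.row_succ hM q
      have e2 := h'.row_succ hM' q
      have : ν * ((q : ℝ) + 1) ≠ 0 := by positivity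
      refine mul_left_cancel₀ this ?_
      linear_combination (∑' z, p' 0 z) * e1 - (∑' z, p 0 z) * e2 + arrivalRate lam K q * ih
  have s1 := (hp.prod_fiberwise fun q => (hp.summable.prod_factor q).hasSum).mul_left
    (∑' z, p' 0 z)
  have s2 := (hp'.prod_fiberwise fun q => (hp'.summable.prod_factor q).hasSum).mul_left
    (∑' z, p 0 z)
  simp only [h1] at s1
  have h2 := s1.unique s2
  have h3 := h1 q
  rw [mul_one, mul_one] at h2
  rw [h2] at h3
  exact mul_left_cancel₀ (h.row_zero_pos hM hν hp).ne' h3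

/-- The flow of vehicles through the station, computed from its total number and from the number
of uncharged vehicles. -/
theorem flow_eq (h : IsBalanced lam μ ν K M p) (hM : 0 < M) (hν : 0 < ν) (hlam : 0 ≤ lam)
    (hp : Summable fun x : ℕ × ℕ => p x.1 x.2) {EQ EZ Em : ℝ}
    (hQ : HasSum (fun x : ℕ × ℕ => p x.1 x.2 * x.1) EQ)
    (hZ : HasSum (fun x : ℕ × ℕ => p x.1 x.2 * x.2) EZ)
    (hm : HasSum (fun x : ℕ × ℕ => p x.1 x.2 * min (x.2 : ℝ) M) Em) :
    ν * EQ = ν * EZ + μ * Em := by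
  have hs : Summable fun x : ℕ × ℕ => arrivalRate lam K x.1 * p x.1 x.2 :=
    Summable.of_nonneg_of_le (fun x => mul_nonneg (arrivalRate_nonneg hlam K _) (h.nonneg _ _))
      (fun x => mul_le_mul_of_nonneg_right (arrivalRate_le hlam K _) (h.nonneg _ _))
      (hp.mul_left lam)
  -- The total arrival rate is summed by rows and by columns; each recursion raises the index by
  -- one, and the omitted zeroth terms vanish.
  have h1 := hs.hasSum.prod_fiberwise fun q =>
    (hp.prod_factor q).hasSum.mul_left (arrivalRate lam K q)
  have h2 := (HasSum.prod_fiberwise ((Equiv.prodComm ℕ ℕ).hasSum_iff.2 hs.hasSum) fun z =>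
    h.hasSum_column hM hν hlam hp z)
  have h3 := (HasSum.marginal_fst hp (φ := fun q => (q : ℝ)) hQ).mul_left ν
  rw [← hasSum_nat_add_iff' 1] at h3
  simp only [Finset.range_one, Finset.sum_singleton, Nat.cast_zero, mul_zero, sub_zero] at h3
  have h4 := ((HasSum.marginal_snd hp (φ := fun z => (z : ℝ)) hZ).mul_left ν).add
    ((HasSum.marginal_snd hp (φ := fun z => min (z : ℝ) M) hm).mul_left μ)
  rw [← hasSum_nat_add_iff' 1] at h4
  simp only [Finset.range_one, Finset.sum_singleton, Nat.cast_zero, mul_zero, sub_zero,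
    min_eq_left hM.le, add_zero] at h4
  have e1 := h1.unique (h3.congr_fun (fun q => by
    have := h.row_succ hM q; push_cast; linarith) )
  have e2 := h2.unique (h4.congr_fun (fun q => by push_cast; ring))
  linarith

end IsBalanced
end Charging

/-! ### Likelihood-ratio comparison and a minimum principle -/

/-- A likelihood-ratio comparison: if `u` is smaller than `v` in the likelihood-ratio order and
`m z / z` is decreasing, then the `u`-mean of `m` relative to the `u`-mean of `z` is the larger. -/
theorem mul_le_mul_of_likelihoodRatio {u v m : ℕ → ℝ}
    (huv : ∀ i j, i ≤ j → u j * v i ≤ u i * v j) (hm : ∀ i j : ℕ, i ≤ j → i * m j ≤ j * m i)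
    {EZ Em EZ' Em' : ℝ} (hZ : HasSum (fun z => u z * (z : ℝ)) EZ)
    (hm1 : HasSum (fun z => u z * m z) Em) (hZ' : HasSum (fun z => v z * (z : ℝ)) EZ')
    (hm2 : HasSum (fun z => v z * m z) Em') : EZ * Em' ≤ EZ' * Em := by
  refine le_of_tendsto_of_tendsto' (hZ.tendsto_sum_nat.mul hm2.tendsto_sum_nat)
    (hZ'.tendsto_sum_nat.mul hm1.tendsto_sum_nat) fun n => ?_
  rw [Finset.sum_mul_sum, Finset.sum_mul_sum, ← sub_nonpos, ← Finset.sum_sub_distrib]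
  simp_rw [← Finset.sum_sub_distrib]
  -- Symmetrizing in `i` and `j` factors each term into two differences of equal sign, as in
  -- Chebyshev's sum inequality.
  have hcomm := Finset.sum_comm (s := Finset.range n) (t := Finset.range n)
    (f := fun i j => u i * (i : ℝ) * (v j * m j) - v i * (i : ℝ) * (u j * m j))
  have hsym : ∑ i ∈ Finset.range n, ∑ j ∈ Finset.range n,
      ((u i * (i : ℝ) * (v j * m j) - v i * (i : ℝ) * (u j * m j))
        + (u j * (j : ℝ) * (v i * m i) - v j * (j : ℝ) * (u i * m i))) ≤ 0 := by
    refine Finset.sum_nonpos fun i _ => Finset.sum_nonpos fun j _ => ?_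
    have e : (u i * (i : ℝ) * (v j * m j) - v i * (i : ℝ) * (u j * m j))
        + (u j * (j : ℝ) * (v i * m i) - v j * (j : ℝ) * (u i * m i))
        = - ((j * m i - i * m j) * (u i * v j - u j * v i)) := by ring
    rw [e, neg_nonpos]
    rcases le_total i j with hij | hij
    · exact mul_nonneg (sub_nonneg.2 (hm i j hij)) (sub_nonneg.2 (huv i j hij))
    · exact mul_nonneg_of_nonpos_of_nonpos (sub_nonpos.2 (hm j i hij)) (sub_nonpos.2 (huv j i hij))
  simp_rw [Finset.sum_add_distrib] at hsym
  linarith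

/-- The ratio u/v cannot increase in one step; cross-multiplication avoids requiring `v` to be
positive. -/
theorem likelihoodRatio_of_succ {u v g : ℕ → ℝ} {lam : ℝ} (hlam : 0 ≤ lam)
    (hv : ∀ z, 0 ≤ v z) (hg : ∀ z, 0 < g z)
    (hu' : ∀ z, g z * u (z + 1) ≤ lam * u z) (hv' : ∀ z, g z * v (z + 1) = lam * v z)
    (i j : ℕ) (hij : i ≤ j) : u j * v i ≤ u i * v j := by
  induction j, hij using Nat.le_induction with
  | base => exact le_rfl
  | succ j _ ih =>
    refine le_of_mul_le_mul_left ?_ (hg j)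
    calc g j * (u (j + 1) * v i) = (g j * u (j + 1)) * v i := by ring
      _ ≤ lam * u j * v i := mul_le_mul_of_nonneg_right (hu' j) (hv i)
      _ = lam * (u j * v i) := by ring
      _ ≤ lam * (u i * v j) := mul_le_mul_of_nonneg_left ih hlam
      _ = g j * (u i * v (j + 1)) := by linear_combination - u i * hv' j

/-- A minimum principle for nearest-neighbour operators on `{0, …, n}` with killing. -/
theorem nonneg_of_superharmonic {n : ℕ} {f κ α β : ℕ → ℝ} (hκ : ∀ z ≤ n, 0 < κ z)
    (hα : ∀ z ≤ n, 0 ≤ α z) (hβ : ∀ z ≤ n, 0 ≤ β z) (hβn : β n = 0)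
    (h : ∀ z ≤ n, β z * f (z + 1) + α z * f (z - 1) ≤ (κ z + β z + α z) * f z) :
    ∀ z ≤ n, 0 ≤ f z := by
  obtain ⟨z₀, hz₀, hmin⟩ := Finset.exists_min_image (Finset.range (n + 1)) f ⟨0, by simp⟩
  have hz₀' : z₀ ≤ n := by have := Finset.mem_range.1 hz₀; omega
  have hmin' : ∀ z ≤ n, f z₀ ≤ f z := fun z hz => hmin z (Finset.mem_range.2 (by omega))
  suffices 0 ≤ f z₀ from fun z hz => this.trans (hmin' z hz)
  -- The neighbour above `n` has weight zero; below 0, truncation returns 0 itself, so the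
  -- comparison is trivial.
  have h1 : β z₀ * f z₀ ≤ β z₀ * f (z₀ + 1) := by
    rcases hz₀'.eq_or_lt with rfl | hlt
    · simp [hβn]
    · exact mul_le_mul_of_nonneg_left (hmin' _ hlt) (hβ _ hz₀')
  have h2 : α z₀ * f z₀ ≤ α z₀ * f (z₀ - 1) :=
    mul_le_mul_of_nonneg_left (hmin' _ (by omega)) (hα _ hz₀')
  have h3 : 0 ≤ κ z₀ * f z₀ := by linarith [h z₀ hz₀']
  exact nonneg_of_mul_nonneg_right h3 (hκ z₀ hz₀')

/-! ### Poisson's equation for the full parking lot -/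

namespace Charging

/-- The decrements of the solution of Poisson's equation for the full parking lot with `k + 1`
places and the cost `z - c`. -/
noncomputable def poissonSlope (μ ν M c : ℝ) (k : ℕ) : ℕ → ℝ
  | 0 => c / (ν * (k + 1))
  | z + 1 => (c - (z + 1) + μ * min ((z + 1 : ℕ) : ℝ) M * poissonSlope μ ν M c k z) / (ν * (k - z))

section Poisson

variable {μ ν M c : ℝ} {k : ℕ}

theorem poissonSlope_zero (hν : 0 < ν) : ν * (k + 1) * poissonSlope μ ν M c k 0 = c := by
  rw [poissonSlope]
  field_simp

theorem poissonSlope_succ (hν : 0 < ν) {z : ℕ} (hz : z < k) :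
    ν * (k - z) * poissonSlope μ ν M c k (z + 1)
      - μ * min ((z + 1 : ℕ) : ℝ) M * poissonSlope μ ν M c k z = c - (z + 1) := by
  rw [poissonSlope]
  have : (0 : ℝ) < k - z := sub_pos.2 (by exact_mod_cast hz)
  field_simp
  ring

/-- Summation by parts moves the generator onto the solution of Poisson's equation, leaving a
boundary term at `n + 1`. -/
theorem sum_poissonSlope_mul (hν : 0 < ν) (u : ℕ → ℝ) {n : ℕ} (hn : n ≤ k) :
    ∑ z ∈ Finset.range (n + 1), poissonSlope μ ν M c k z *
        (ν * (k + 1 - z) * u z - μ * min ((z + 1 : ℕ) : ℝ) M * u (z + 1))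
      = ∑ z ∈ Finset.range (n + 1), (c - z) * u z
        - μ * min ((n + 1 : ℕ) : ℝ) M * poissonSlope μ ν M c k n * u (n + 1) := by
  induction n with
  | zero =>
    have h0 := poissonSlope_zero (μ := μ) (M := M) (c := c) (k := k) hν
    simp only [zero_add, Finset.range_one, Finset.sum_singleton, Nat.cast_zero, sub_zero]
    linear_combination u 0 * h0
  | succ n ih =>
    have h1 := poissonSlope_succ (μ := μ) (M := M) (c := c) hν (show n < k by omega)
    rw [Finset.sum_range_succ, ih (by omega), Finset.sum_range_succ (fun z : ℕ => (c - z) * u z) (n + 1)]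
    push_cast at h1 ⊢
    linear_combination u (n + 1) * h1

theorem min_succ_sub_nonneg (z : ℕ) (M : ℝ) : 0 ≤ min ((z + 1 : ℕ) : ℝ) M - min (z : ℝ) M :=
  sub_nonneg.2 (min_le_min_right M (by push_cast; linarith))

theorem min_concave (z : ℕ) (M : ℝ) :
    min ((z + 1 + 1 : ℕ) : ℝ) M - min ((z + 1 : ℕ) : ℝ) M
      ≤ min ((z + 1 : ℕ) : ℝ) M - min (z : ℝ) M := by
  push_cast
  rcases le_total ((z : ℝ) + 1) M with h | h
  · rw [min_eq_left h, min_eq_left (by linarith : (z : ℝ) ≤ M)]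
    linarith [min_le_left ((z : ℝ) + 1 + 1) M]
  · rw [min_eq_right h]
    linarith [min_le_right ((z : ℝ) + 1 + 1) M, min_le_right (z : ℝ) M]

/-- The mean of `u` is at most that of the invariant law `v` of the full parking lot, if the fluxes
of `u` have nonnegative tails. -/
theorem mean_le_of_flux (hμ : 0 < μ) (hν : 0 < ν) (hM : 0 < M) {u v V : ℕ → ℝ}
    (hu : ∑ z ∈ Finset.range (k + 1 + 1), u z = 1) (hv : ∑ z ∈ Finset.range (k + 1 + 1), v z = 1)
    (hvcut : ∀ z ≤ k, μ * min ((z + 1 : ℕ) : ℝ) M * v (z + 1) = ν * (k + 1 - z) * v z)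
    (hV : ∀ z, 0 ≤ V z) (hVk : V (k + 1) = 0)
    (hflux : ∀ z ≤ k, V z - V (z + 1)
      ≤ ν * (k + 1 - z) * u z - μ * min ((z + 1 : ℕ) : ℝ) M * u (z + 1)) :
    ∑ z ∈ Finset.range (k + 1 + 1), z * u z ≤ ∑ z ∈ Finset.range (k + 1 + 1), z * v z := by
  set c := ∑ z ∈ Finset.range (k + 1 + 1), z * v z with hc
  set D := poissonSlope μ ν M c k with hD
  -- A zero at the top would propagate down to all of `v` through detailed balance.
  have hvk : v (k + 1) ≠ 0 := by
    intro h0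
    have h1 : ∀ i ≤ k + 1, v (k + 1 - i) = 0 := by
      intro i
      induction i with
      | zero => intro _; simpa using h0
      | succ i ih =>
        intro hi
        have h2 := hvcut (k + 1 - (i + 1)) (by omega)
        rw [show k + 1 - (i + 1) + 1 = k + 1 - i by omega, ih (by omega), mul_zero] at h2
        refine (mul_eq_zero.1 h2.symm).resolve_left (mul_pos hν ?_).ne'
        have : ((k + 1 - (i + 1) : ℕ) : ℝ) ≤ k := by exact_mod_cast (by omega)
        linarith
    rw [Finset.sum_eq_zero fun z hz => ?_] at hv
    · exact zero_ne_one hv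
    · have := h1 (k + 1 - z) (by omega)
      rwa [show k + 1 - (k + 1 - z) = z by have := Finset.mem_range.1 hz; omega] at this
  have hcent : ∀ w : ℕ → ℝ, ∑ z ∈ Finset.range (k + 1 + 1), w z = 1 →
      ∑ z ∈ Finset.range (k + 1), (c - z) * w z + (c - (k + 1)) * w (k + 1)
        = c - ∑ z ∈ Finset.range (k + 1 + 1), z * w z := by
    intro w hw
    have := Finset.sum_range_succ (fun z : ℕ => (c - z) * w z) (k + 1)
    push_cast at this
    rw [← this]
    simp_rw [sub_mul, Finset.sum_sub_distrib, ← Finset.mul_sum, hw, mul_one]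
  -- Poisson's equation at the top state is not part of the recursion; it holds because `c` is the
  -- mean under `v`.
  have hlast : - (μ * min ((k + 1 : ℕ) : ℝ) M * D k) = c - (k + 1) := by
    have h1 := sum_poissonSlope_mul (μ := μ) (M := M) (c := c) hν v (le_refl k)
    rw [Finset.sum_eq_zero fun z hz => by
      rw [hvcut z (by have := Finset.mem_range.1 hz; omega), sub_self, mul_zero]] at h1
    have h2 := hcent v hv
    rw [← hc, sub_self] at h2
    refine mul_right_cancel₀ hvk ?_
    linarith
  have hE0 : ν * (k + 1) * D 0 = c := poissonSlope_zero hν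
  -- At `z = k` the junk value `D (k + 1)` has coefficient zero.
  have hE : ∀ z ≤ k, ν * (k - z) * D (z + 1) - μ * min ((z + 1 : ℕ) : ℝ) M * D z = c - (z + 1) := by
    intro z hz
    rcases hz.eq_or_lt with rfl | hlt
    · linarith
    · exact poissonSlope_succ hν hlt
  have hm0 : ∀ z : ℕ, 0 ≤ μ * min (z : ℝ) M := fun z => by positivity
  have hmz : min ((0 : ℕ) : ℝ) M = 0 := by simpa using hM.le
  -- Differencing Poisson's equation gives an equation for `D` with source 1 and killing at least
  -- `ν`.
  have hR : ∀ z ≤ k, ((ν + μ * (min ((z + 1 : ℕ) : ℝ) M - min (z : ℝ) M)) + ν * (k - z)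
      + μ * min (z : ℝ) M) * D z
      = 1 + ν * (k - z) * D (z + 1) + μ * min (z : ℝ) M * D (z - 1) := by
    intro z hz
    have h1 := hE z hz
    rcases z with _ | z
    · rw [hmz]
      push_cast at h1 ⊢
      linear_combination hE0 - h1
    · have h2 := hE z (by omega)
      rw [Nat.add_sub_cancel]
      push_cast at h1 h2 ⊢
      linear_combination h2 - h1
  have hDpos : ∀ z ≤ k, 0 ≤ D z := by
    refine nonneg_of_superharmonic (κ := fun z => ν + μ * (min ((z + 1 : ℕ) : ℝ) M - min (z : ℝ) M))
      (β := fun z => ν * (k - z)) (α := fun z => μ * min (z : ℝ) M) (fun z _ => ?_)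
      (fun z _ => hm0 z) (fun z hz => ?_) (by simp) (fun z hz => ?_)
    · have := mul_nonneg hμ.le (min_succ_sub_nonneg z M)
      linarith
    · have : (z : ℝ) ≤ k := by exact_mod_cast hz
      exact mul_nonneg hν.le (by linarith)
    · have := hR z hz
      linarith
  -- Differencing again, concavity of min(z,M) together with `D ≥ 0` makes the remaining source
  -- nonnegative.
  have hDmono : ∀ z, z + 1 ≤ k → D z ≤ D (z + 1) := by
    intro z hz
    obtain ⟨n, rfl⟩ : ∃ n, k = n + 1 := ⟨k - 1, by omega⟩
    refine sub_nonneg.1 (nonneg_of_superharmonic (n := n) (f := fun z => D (z + 1) - D z)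
      (κ := fun z => 2 * ν + μ * (min ((z + 1 + 1 : ℕ) : ℝ) M - min ((z + 1 : ℕ) : ℝ) M)
        + μ * (min ((z + 1 : ℕ) : ℝ) M - min (z : ℝ) M))
      (β := fun z => ν * (n - z)) (α := fun z => μ * min (z : ℝ) M) (fun z _ => ?_)
      (fun z _ => hm0 z) (fun z hz => ?_) (by simp) (fun z hz => ?_) z
      (by omega))
    · have h1 := mul_nonneg hμ.le (min_succ_sub_nonneg z M)
      have h2 := mul_nonneg hμ.le (min_succ_sub_nonneg (z + 1) M)
      linarith
    · have : (z : ℝ) ≤ n := by exact_mod_cast hz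
      exact mul_nonneg hν.le (by linarith)
    · have h1 := hR z (by omega)
      have h2 := hR (z + 1) (by omega)
      have h3 := mul_nonneg (mul_nonneg hμ.le (sub_nonneg.2 (min_concave z M))) (hDpos z (by omega))
      rcases z with _ | z
      · rw [hmz] at h1 h3 ⊢
        rw [Nat.add_sub_cancel] at h2
        push_cast at h1 h2 h3 ⊢
        linarith
      · rw [Nat.add_sub_cancel] at h1 h2 ⊢
        push_cast at h1 h2 h3 ⊢
        linarith
  -- Abel summation: the discarded terms pair `V ≥ 0` with `D 0` and with the increments of `D`.
  have habel : ∀ n ≤ k, - (D n * V (n + 1)) ≤ ∑ z ∈ Finset.range (n + 1), D z *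
      (ν * (k + 1 - z) * u z - μ * min ((z + 1 : ℕ) : ℝ) M * u (z + 1)) := by
    intro n
    induction n with
    | zero =>
      intro hn
      rw [zero_add, Finset.range_one, Finset.sum_singleton]
      have h1 := mul_le_mul_of_nonneg_left (hflux 0 hn) (hDpos 0 hn)
      have h2 := mul_nonneg (hDpos 0 hn) (hV 0)
      rw [zero_add] at h1
      linarith
    | succ n ih =>
      intro hn
      rw [Finset.sum_range_succ]
      have h1 := mul_le_mul_of_nonneg_left (hflux (n + 1) hn) (hDpos (n + 1) hn)
      have h2 := mul_nonneg (sub_nonneg.2 (hDmono n hn)) (hV (n + 1))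
      have h3 := ih (by omega)
      linarith
  have h1 := habel k le_rfl
  rw [hVk, mul_zero, neg_zero, sum_poissonSlope_mul hν u le_rfl] at h1
  have h2 := hcent u hu
  have h3 : (c - (k + 1)) * u (k + 1) = - (μ * min ((k + 1 : ℕ) : ℝ) M * D k) * u (k + 1) := by
    rw [hlast]
  linarith

end Poisson

/-- Detailed balance for the full parking lot. -/
theorem cut_of_isFullLot {Ω : Type*} [MeasurableSpace Ω] {μ ν : ℝ} {K : ℕ} {M : ℝ}
    {P : Measure Ω} [IsProbabilityMeasure P] {Zf : ℝ≥0 → Ω → ℕ} (hZ : IsFullLot μ ν K M P Zf)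
    {π : Measure ℕ} (hπ : IsSteadyStateLaw P Zf π) (z : ℕ) :
    μ * min ((z + 1 : ℕ) : ℝ) M * π.real {z + 1} = ν * (K - z) * π.real {z} := by
  -- The generator of this step function sees only the two jumps across the cut between `z` and `z +
  -- 1`.
  let f : ℕ → ℝ := fun i => if i ≤ z then 1 else 0
  have hf : (Function.support f).Finite := by
    refine (Set.finite_Iic z).subset fun x hx => ?_
    by_contra h
    exact hx (if_neg h)
  have key := hπ.sum_generator_eq_zero hZ hf {z, z + 1} (fun x _ hx => by
    simp only [Finset.mem_insert, Finset.mem_singleton, not_or] at hx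
    simp only [fullGenerator, f]
    rcases lt_or_ge x z with h | h
    · rw [if_pos (by omega), if_pos (by omega), if_pos (by omega)]; ring
    · rw [if_neg (by omega), if_neg (by omega), if_neg (by omega)]; ring)
  rw [Finset.sum_pair (by omega)] at key
  simp only [fullGenerator, f] at key
  simp only [if_neg (show ¬ z + 1 ≤ z by omega), if_pos (le_refl z),
    if_pos (show z - 1 ≤ z by omega), if_neg (show ¬ z + 1 + 1 ≤ z by omega),
    if_pos (show z + 1 - 1 ≤ z by omega)] at key
  linarith

/-! ### Positivity of the net flux and comparison with the full lot -/

namespace IsBalanced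

variable {lam μ ν : ℝ} {K : ℕ} {M : ℝ} {p : ℕ → ℕ → ℝ}

theorem netFlux_capacity (h : IsBalanced lam μ ν K M p) (hM : 0 < M) (hν : 0 < ν)
    (hlam : 0 ≤ lam) (z : ℕ) : netFlux lam μ ν K M p K z = 0 := by
  have h1 := h.abs_netFlux_le hM hν hlam K z
  rw [arrivalRate, if_neg (lt_irrefl _), zero_mul] at h1
  exact abs_eq_zero.1 (le_antisymm h1 (abs_nonneg _))

/-- A negative minimum must avoid `z = 0`, `z > q` and `q = K`, where the flux is zero. At any other
minimum, superharmonicity and `lam > 0` force the same value at `(q - 1, z - 1)`; descending this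
diagonal reaches the boundary. -/
theorem netFlux_nonneg (h : IsBalanced lam μ ν K M p) (hM : 0 < M) (hμ : 0 < μ) (hν : 0 < ν)
    (hlam : 0 < lam) {q : ℕ} (hq : q ≤ K) (z : ℕ) : 0 ≤ netFlux lam μ ν K M p q z := by
  set U := netFlux lam μ ν K M p with hU
  obtain ⟨⟨q₀, z₀⟩, hmem, hmin⟩ := Finset.exists_min_image
    (Finset.range (K + 1) ×ˢ Finset.range (K + 1)) (fun x => U x.1 x.2) ⟨(0, 0), by simp⟩
  have hq₀ : q₀ ≤ K := by
    have := (Finset.mem_product.1 hmem).1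
    simp only [Finset.mem_range] at this
    omega
  have hle : ∀ q ≤ K, ∀ z ≤ q, U q₀ z₀ ≤ U q z := fun q hq z hz =>
    hmin (q, z) (by simp only [Finset.mem_product, Finset.mem_range]; omega)
  by_contra hneg
  have hlt : U q₀ z₀ < 0 := by
    rcases lt_or_ge q z with hz | hz
    · exact absurd (h.netFlux_eq_zero_of_lt hz).ge hneg
    · exact (hle q hq z hz).trans_lt (not_le.1 hneg)
  have hle' : ∀ q ≤ K, ∀ z, U q₀ z₀ ≤ U q z := by
    intro q hq z
    rcases lt_or_ge q z with hz | hz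
    · exact hlt.le.trans (h.netFlux_eq_zero_of_lt hz).ge
    · exact hle q hq z hz
  have hne : ∀ z, ∀ q ≤ K, U q₀ z₀ < U q z := by
    intro z
    induction z with
    | zero => exact fun q _ => hlt.trans_le (netFlux_zero_right hM q).ge
    | succ z ih =>
      intro q hq
      refine lt_of_le_of_ne (hle' q hq _) fun heq => ?_
      rcases lt_or_ge q (z + 1) with hz | hz
      · exact absurd (heq.trans (h.netFlux_eq_zero_of_lt hz)) hlt.ne
      rcases hq.eq_or_lt with rfl | hqK
      · exact absurd (heq.trans (h.netFlux_capacity hM hν hlam.le _)) hlt.ne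
      obtain ⟨r, rfl⟩ : ∃ r, q = r + 1 := ⟨q - 1, by omega⟩
      have h0 := h.netFlux_superharmonic hM hμ hν r z (by exact_mod_cast hqK)
      rw [← hU, ← heq] at h0
      have hrz : (z : ℝ) ≤ r := by exact_mod_cast (by omega : z ≤ r)
      have t1 := mul_pos hlam (sub_pos.2 (ih r (by omega)))
      have t2 := mul_nonneg (by positivity : 0 ≤ ν * ((z : ℝ) + 1))
        (sub_nonneg.2 (hle' (r + 2) (by omega) (z + 2)))
      have t3 := mul_nonneg (by positivity : 0 ≤ μ * min ((z + 1 : ℕ) : ℝ) M)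
        (sub_nonneg.2 (hle' (r + 1) (by omega) (z + 2)))
      have t4 := mul_nonneg (mul_nonneg hν.le (by linarith) : 0 ≤ ν * ((r : ℝ) - z + 1))
        (sub_nonneg.2 (hle' (r + 2) (by omega) (z + 1)))
      linarith
  exact lt_irrefl _ (hne z₀ q₀ hq₀)

/-- Vanishing flux at capacity replaces the arrival terms. The only loss is in bounding the
departure rate ν(q - z) of charged vehicles by the birth rate ν(K - z) of the full lot. -/
theorem sum_netFlux_sub_le (h : IsBalanced lam μ ν K M p) (hM : 0 < M) (hν : 0 < ν)
    (hlam : 0 ≤ lam) (z : ℕ) :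
    ∑ q ∈ Finset.range K, netFlux lam μ ν K M p q z
        - ∑ q ∈ Finset.range K, netFlux lam μ ν K M p q (z + 1)
      ≤ ν * (K - z) * ∑ q ∈ Finset.range (K + 1), p q z
        - μ * min ((z + 1 : ℕ) : ℝ) M * ∑ q ∈ Finset.range (K + 1), p q (z + 1) := by
  rw [← Finset.sum_sub_distrib, Finset.sum_congr rfl fun q _ => h.netFlux_sub hM q z]
  rw [Finset.sum_sub_distrib, Finset.sum_add_distrib]
  have h1 := h.netFlux_capacity hM hν hlam (z + 1)
  rw [netFlux, Finset.sum_sub_distrib, ← Finset.mul_sum, Finset.sum_range_succ' (fun i =>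
    arrivalFlux (arrivalRate lam K) p i (z + 1))] at h1
  simp only [arrivalFlux, add_zero] at h1
  have h2 : ∑ q ∈ Finset.range K, ν * ((z : ℝ) + 1) * p (q + 1) (z + 1)
      = ν * (z + 1) * ∑ q ∈ Finset.range (K + 1), p q (z + 1) := by
    rw [Finset.mul_sum, Finset.sum_range_succ', h.eq_zero_of_lt (show 0 < z + 1 by omega)]
    ring
  have h3 : ∑ q ∈ Finset.range K, ν * ((q : ℝ) + 1 - z) * p (q + 1) z
      ≤ ν * (K - z) * ∑ q ∈ Finset.range (K + 1), p q z := by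
    have h4 : ν * ((0 : ℝ) - z) * p 0 z = 0 := by
      rcases Nat.eq_zero_or_pos z with rfl | hz
      · simp
      · rw [h.eq_zero_of_lt hz, mul_zero]
    have h5 := Finset.sum_range_succ' (fun q : ℕ => ν * ((q : ℝ) - z) * p q z) K
    push_cast at h5
    rw [h4, add_zero] at h5
    rw [← h5, Finset.mul_sum]
    refine Finset.sum_le_sum fun q hq => mul_le_mul_of_nonneg_right ?_ (h.nonneg q z)
    have : (q : ℝ) ≤ K := by
      exact_mod_cast (by have := Finset.mem_range.1 hq; omega : q ≤ K)
    exact mul_le_mul_of_nonneg_left (by linarith) hν.le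
  rw [h2]
  push_cast at h1 ⊢
  linarith

end IsBalanced
end Charging

/-! ### Steady-state means and their comparison -/

namespace Charging

section SteadyState

variable {Ω : Type*} [MeasurableSpace Ω] {lam μ ν : ℝ} {K : ℕ∞} {M : ℝ} {P : Measure Ω}
  {Y : ℝ≥0 → Ω → ℕ × ℕ} {π : Measure (ℕ × ℕ)}

theorem hasSum_steadyState (hπ : IsSteadyStateLaw P Y π) :
    HasSum (fun x : ℕ × ℕ => π.real {(x.1, x.2)}) 1 := by
  have := hπ.isProbabilityMeasure
  simpa using hasSum_measureReal_mul_integral (integrable_const (μ := π) (1 : ℝ))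

theorem ae_mem_states (hY : IsStation lam μ ν K M P Y) (hπ : IsSteadyStateLaw P Y π) :
    ∀ᵐ x ∂π, x ∈ states K := by
  have := hπ.isProbabilityMeasure
  rw [ae_iff_of_countable]
  intro x hx
  by_contra h
  have h1 := hπ.measureReal_eq_zero hY (x := x) h
  exact hx ((measureReal_eq_zero_iff).1 h1)

variable [IsProbabilityMeasure P]

theorem integrable_fst (hlam : 0 < lam) (hν : 0 < ν) (hM : 0 < M)
    (hY : IsStation lam μ ν K M P Y) (hπ : IsSteadyStateLaw P Y π) :
    Integrable (fun x : ℕ × ℕ => (x.1 : ℝ)) π := by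
  have := hπ.isProbabilityMeasure
  refine integrable_of_summable_measureReal_mul ?_
  simpa using (isBalanced_of_isSteadyStateLaw hM hY hπ).summable_fst hM hν hlam.le
    (hasSum_steadyState hπ).summable

theorem integrable_snd (hlam : 0 < lam) (hν : 0 < ν) (hM : 0 < M)
    (hY : IsStation lam μ ν K M P Y) (hπ : IsSteadyStateLaw P Y π) :
    Integrable (fun x : ℕ × ℕ => (x.2 : ℝ)) π := by
  refine (integrable_fst hlam hν hM hY hπ).mono' (measurable_of_countable _).aestronglyMeasurable ?_
  filter_upwards [ae_mem_states hY hπ] with x hx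
  simpa using hx.1

theorem integrable_min_snd (hlam : 0 < lam) (hν : 0 < ν) (hM : 0 < M)
    (hY : IsStation lam μ ν K M P Y) (hπ : IsSteadyStateLaw P Y π) :
    Integrable (fun x : ℕ × ℕ => min (x.2 : ℝ) M) π := by
  refine (integrable_snd hlam hν hM hY hπ).mono' (measurable_of_countable _).aestronglyMeasurable ?_
  refine Eventually.of_forall fun x => ?_
  rw [Real.norm_of_nonneg (by positivity)]
  exact min_le_left _ _

theorem meanCharged_eq (hlam : 0 < lam) (hν : 0 < ν) (hM : 0 < M)
    (hY : IsStation lam μ ν K M P Y) (hπ : IsSteadyStateLaw P Y π) :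
    meanCharged π = meanTotal π - ∫ x, (x.2 : ℝ) ∂π :=
  integral_sub (integrable_fst hlam hν hM hY hπ) (integrable_snd hlam hν hM hY hπ)

/-- In steady state, vehicles become fully charged at the rate at which fully charged vehicles
leave. -/
theorem charging_flow (hlam : 0 < lam) (hν : 0 < ν) (hM : 0 < M)
    (hY : IsStation lam μ ν K M P Y) (hπ : IsSteadyStateLaw P Y π) :
    ν * meanTotal π = ν * ∫ x, (x.2 : ℝ) ∂π + μ * ∫ x, min (x.2 : ℝ) M ∂π :=
  (isBalanced_of_isSteadyStateLaw hM hY hπ).flow_eq hM hν hlam.le (hasSum_steadyState hπ).summable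
    (hasSum_measureReal_mul_integral (integrable_fst hlam hν hM hY hπ))
    (hasSum_measureReal_mul_integral (integrable_snd hlam hν hM hY hπ))
    (hasSum_measureReal_mul_integral (integrable_min_snd hlam hν hM hY hπ))

theorem hasSum_meanTotal (hlam : 0 < lam) (hν : 0 < ν) (hM : 0 < M)
    (hY : IsStation lam μ ν K M P Y) (hπ : IsSteadyStateLaw P Y π) :
    HasSum (fun q : ℕ => (∑' z, π.real {(q, z)}) * (q : ℝ)) (meanTotal π) :=
  HasSum.marginal_fst (p := fun q z => π.real {(q, z)}) (hasSum_steadyState hπ).summable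
    (hasSum_measureReal_mul_integral (integrable_fst hlam hν hM hY hπ))

theorem hasSum_meanUncharged (hlam : 0 < lam) (hν : 0 < ν) (hM : 0 < M)
    (hY : IsStation lam μ ν K M P Y) (hπ : IsSteadyStateLaw P Y π) :
    HasSum (fun z : ℕ => (∑' q, π.real {(q, z)}) * (z : ℝ)) (∫ x, (x.2 : ℝ) ∂π) :=
  HasSum.marginal_snd (p := fun q z => π.real {(q, z)}) (hasSum_steadyState hπ).summable
    (hasSum_measureReal_mul_integral (integrable_snd hlam hν hM hY hπ))

theorem hasSum_meanPower (hlam : 0 < lam) (hν : 0 < ν) (hM : 0 < M)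
    (hY : IsStation lam μ ν K M P Y) (hπ : IsSteadyStateLaw P Y π) :
    HasSum (fun z : ℕ => (∑' q, π.real {(q, z)}) * min (z : ℝ) M) (∫ x, min (x.2 : ℝ) M ∂π) :=
  HasSum.marginal_snd (p := fun q z => π.real {(q, z)}) (φ := fun z => min (z : ℝ) M)
    (hasSum_steadyState hπ).summable
    (hasSum_measureReal_mul_integral (integrable_min_snd hlam hν hM hY hπ))

theorem meanTotal_pos (hlam : 0 < lam) (hν : 0 < ν) (hM : 0 < M) (hK : 0 < K)
    (hY : IsStation lam μ ν K M P Y) (hπ : IsSteadyStateLaw P Y π) : 0 < meanTotal π := by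
  have h := isBalanced_of_isSteadyStateLaw hM hY hπ
  have h1 := h.row_succ hM 0
  have h2 := mul_pos hlam (h.row_zero_pos hM hν (hasSum_steadyState hπ))
  rw [arrivalRate, if_pos (by exact_mod_cast hK)] at h1
  rw [← h1] at h2
  have h3 : 0 < ∑' z, π.real {(0 + 1, z)} := pos_of_mul_pos_right h2 (by positivity)
  refine h3.trans_le ?_
  have h4 := le_hasSum (hasSum_meanTotal hlam hν hM hY hπ) 1 fun q _ =>
    mul_nonneg (tsum_nonneg fun _ => measureReal_nonneg) (Nat.cast_nonneg q)
  simpa using h4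

/-- The mean number of vehicles does not depend on the power. -/
theorem meanTotal_eq {Ω' : Type*} [MeasurableSpace Ω'] {P' : Measure Ω'} [IsProbabilityMeasure P']
    {Y' : ℝ≥0 → Ω' → ℕ × ℕ} {π' : Measure (ℕ × ℕ)} {M' : ℝ} (hlam : 0 < lam) (hν : 0 < ν)
    (hM : 0 < M) (hY : IsStation lam μ ν K M P Y) (hπ : IsSteadyStateLaw P Y π) (hM' : 0 < M')
    (hY' : IsStation lam μ ν K M' P' Y') (hπ' : IsSteadyStateLaw P' Y' π') :
    meanTotal π = meanTotal π' := by
  have h1 := hasSum_meanTotal hlam hν hM hY hπ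
  have h2 : ∀ q, ∑' z, π.real {(q, z)} = ∑' z, π'.real {(q, z)} :=
    (isBalanced_of_isSteadyStateLaw hM hY hπ).row_eq hM hν (hasSum_steadyState hπ)
      (isBalanced_of_isSteadyStateLaw hM' hY' hπ') hM' (hasSum_steadyState hπ')
  simp only [h2] at h1
  exact h1.unique (hasSum_meanTotal hlam hν hM' hY' hπ')

theorem integral_min_snd_le (hlam : 0 < lam) (hν : 0 < ν) (hM : 0 < M)
    (hY : IsStation lam μ ν K M P Y) (hπ : IsSteadyStateLaw P Y π) :
    ∫ x, min (x.2 : ℝ) M ∂π ≤ ∫ x, (x.2 : ℝ) ∂π :=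
  integral_mono (integrable_min_snd hlam hν hM hY hπ) (integrable_snd hlam hν hM hY hπ)
    fun _ => min_le_left _ _

end SteadyState

theorem mul_min_le_mul_min {M : ℝ} (hM : 0 < M) {i j : ℕ} (hij : i ≤ j) :
    (i : ℝ) * min (j : ℝ) M ≤ j * min (i : ℝ) M := by
  have h1 : (i : ℝ) ≤ j := by exact_mod_cast hij
  have h0 : (0 : ℝ) ≤ i := i.cast_nonneg
  rcases le_total (i : ℝ) M with h | h
  · rw [min_eq_left h, mul_comm (j : ℝ)]
    exact mul_le_mul_of_nonneg_left (min_le_left _ _) h0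
  · rw [min_eq_right h, min_eq_right (h.trans h1)]
    exact mul_le_mul_of_nonneg_right h1 hM.le

/-- The charging power per uncharged vehicle is larger in the station with finite capacity. -/
theorem meanUncharged_mul_le {lam μ ν M : ℝ} {K : ℕ∞} (hlam : 0 < lam) (hμ : 0 < μ) (hν : 0 < ν)
    (hM : 0 < M)
    {Ω₁ : Type*} [MeasurableSpace Ω₁] {P₁ : Measure Ω₁} [IsProbabilityMeasure P₁]
    {Y : ℝ≥0 → Ω₁ → ℕ × ℕ} (hY : IsStation lam μ ν K M P₁ Y)
    {π : Measure (ℕ × ℕ)} (hπ : IsSteadyStateLaw P₁ Y π)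
    {Ω₂ : Type*} [MeasurableSpace Ω₂] {P₂ : Measure Ω₂} [IsProbabilityMeasure P₂]
    {Yinf : ℝ≥0 → Ω₂ → ℕ × ℕ} (hYinf : IsStation lam μ ν ⊤ M P₂ Yinf)
    {πinf : Measure (ℕ × ℕ)} (hπinf : IsSteadyStateLaw P₂ Yinf πinf) :
    (∫ x, (x.2 : ℝ) ∂π) * ∫ x, min (x.2 : ℝ) M ∂πinf
      ≤ (∫ x, (x.2 : ℝ) ∂πinf) * ∫ x, min (x.2 : ℝ) M ∂π := by
  have hv := fun z => (isBalanced_of_isSteadyStateLaw hM hYinf hπinf).column_succ_of_top hM hν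
    hlam.le (hasSum_steadyState hπinf).summable z
  have hu := fun z => (isBalanced_of_isSteadyStateLaw hM hY hπ).column_succ_le hM hν
    hlam.le (hasSum_steadyState hπ).summable z
  exact mul_le_mul_of_likelihoodRatio
    (likelihoodRatio_of_succ hlam.le (fun z => tsum_nonneg fun _ => measureReal_nonneg)
      (fun z => by positivity) hu hv)
    (fun i j hij => mul_min_le_mul_min hM hij)
    (hasSum_meanUncharged hlam hν hM hY hπ) (hasSum_meanPower hlam hν hM hY hπ)
    (hasSum_meanUncharged hlam hν hM hYinf hπinf) (hasSum_meanPower hlam hν hM hYinf hπinf)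

/-- The mean number of uncharged vehicles is at most that of the full parking lot. -/
theorem meanUncharged_le_full {lam μ ν M : ℝ} {K : ℕ} (hlam : 0 < lam) (hμ : 0 < μ) (hν : 0 < ν)
    (hM : 0 < M) (hK : 0 < K)
    {Ω₁ : Type*} [MeasurableSpace Ω₁] {P₁ : Measure Ω₁} [IsProbabilityMeasure P₁]
    {Y : ℝ≥0 → Ω₁ → ℕ × ℕ} (hY : IsStation lam μ ν (K : ℕ∞) M P₁ Y)
    {π : Measure (ℕ × ℕ)} (hπ : IsSteadyStateLaw P₁ Y π)
    {Ω₂ : Type*} [MeasurableSpace Ω₂] {P₂ : Measure Ω₂} [IsProbabilityMeasure P₂]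
    {Zf : ℝ≥0 → Ω₂ → ℕ} (hZf : IsFullLot μ ν K M P₂ Zf)
    {πf : Measure ℕ} (hπf : IsSteadyStateLaw P₂ Zf πf) :
    ∫ x, (x.2 : ℝ) ∂π ≤ ∫ z, (z : ℝ) ∂πf := by
  obtain ⟨k, rfl⟩ : ∃ k, K = k + 1 := ⟨K - 1, by omega⟩
  have := hπf.isProbabilityMeasure
  have h := isBalanced_of_isSteadyStateLaw hM hY hπ
  have hcol : ∀ z, ∑' q, π.real {(q, z)} = ∑ q ∈ Finset.range (k + 1 + 1), π.real {(q, z)} :=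
    fun z => tsum_eq_sum fun q hq => h.eq_zero_of_capacity_lt z
      (by rw [Finset.mem_range] at hq; exact_mod_cast (by omega : k + 1 < q))
  have hcol0 : ∀ z, z ∉ Finset.range (k + 1 + 1) →
      ∑ q ∈ Finset.range (k + 1 + 1), π.real {(q, z)} = 0 := fun z hz =>
    Finset.sum_eq_zero fun q hq => h.eq_zero_of_lt (by
      rw [Finset.mem_range] at hz hq; omega)
  have hf0 : ∀ z, z ∉ Finset.range (k + 1 + 1) → πf.real {z} = 0 := fun z hz =>
    hπf.measureReal_eq_zero hZf (by
      rw [Finset.mem_range] at hz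
      simp only [Set.mem_ofPred_eq]; omega)
  have hfint : Integrable (fun z : ℕ => (z : ℝ)) πf :=
    integrable_of_summable_measureReal_mul (summable_of_ne_finset_zero
      (s := Finset.range (k + 1 + 1)) fun z hz => by rw [hf0 z hz, zero_mul])
  have e1 : ∫ x, (x.2 : ℝ) ∂π
      = ∑ z ∈ Finset.range (k + 1 + 1), z * ∑ q ∈ Finset.range (k + 1 + 1), π.real {(q, z)} := by
    rw [← (hasSum_meanUncharged hlam hν hM hY hπ).tsum_eq]
    simp_rw [hcol]
    rw [tsum_eq_sum (s := Finset.range (k + 1 + 1)) fun z hz => by rw [hcol0 z hz, zero_mul]]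
    exact Finset.sum_congr rfl fun z _ => mul_comm _ _
  have e2 : ∫ z, (z : ℝ) ∂πf = ∑ z ∈ Finset.range (k + 1 + 1), z * πf.real {z} := by
    rw [← (hasSum_measureReal_mul_integral hfint).tsum_eq,
      tsum_eq_sum (s := Finset.range (k + 1 + 1)) fun z hz => by rw [hf0 z hz, zero_mul]]
    exact Finset.sum_congr rfl fun z _ => mul_comm _ _
  rw [e1, e2]
  -- The row `q = k + 1` is left out of `V`, so that `V (k + 1) = 0` follows from `q < z`.
  refine mean_le_of_flux hμ hν hM
    (V := fun z => ∑ q ∈ Finset.range (k + 1), netFlux lam μ ν ((k + 1 : ℕ) : ℕ∞) M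
      (fun q z => π.real {(q, z)}) q z) ?_ ?_ ?_ ?_ ?_ ?_
  · have h1 := HasSum.marginal_snd (p := fun q z => π.real {(q, z)}) (φ := fun _ => 1)
      (hasSum_steadyState hπ).summable (by simpa using hasSum_steadyState hπ)
    simp only [mul_one, hcol] at h1
    exact (hasSum_sum_of_ne_finset_zero hcol0).unique h1
  · have h1 := hasSum_measureReal_mul_integral (integrable_const (μ := πf) (1 : ℝ))
    simp only [mul_one, integral_const, probReal_univ, smul_eq_mul] at h1
    exact (hasSum_sum_of_ne_finset_zero hf0).unique h1
  · intro z _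
    have := cut_of_isFullLot hZf hπf z
    push_cast at this ⊢
    exact this
  · exact fun z => Finset.sum_nonneg fun q hq =>
      h.netFlux_nonneg hM hμ hν hlam (Finset.mem_range.1 hq).le z
  · exact Finset.sum_eq_zero fun q hq => h.netFlux_eq_zero_of_lt (Finset.mem_range.1 hq)
  · intro z _
    have := h.sum_netFlux_sub_le hM hν hlam.le z
    push_cast at this ⊢
    exact this

end Charging

/-! ### The three inequalities -/

theorem mainTheorem3
    (lam μ ν : ℝ) (hlam : 0 < lam) (hμ : 0 < μ) (hν : 0 < ν)
    (K : ℕ) (M : ℝ) (hM : 0 < M) (hMK : M ≤ (K : ℝ))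
    -- the system with `K` parking spaces and power `M`
    {Ω₁ : Type*} [MeasurableSpace Ω₁] (P₁ : Measure Ω₁) [IsProbabilityMeasure P₁]
    (Y : ℝ≥0 → Ω₁ → ℕ × ℕ) (hY : Charging.IsStation lam μ ν (K : ℕ∞) M P₁ Y)
    (π : Measure (ℕ × ℕ)) (hπ : IsSteadyStateLaw P₁ Y π)
    -- the system with infinitely many parking spaces and power `M`
    {Ω₂ : Type*} [MeasurableSpace Ω₂] (P₂ : Measure Ω₂) [IsProbabilityMeasure P₂]
    (Yinf : ℝ≥0 → Ω₂ → ℕ × ℕ) (hYinf : Charging.IsStation lam μ ν ⊤ M P₂ Yinf)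
    (πinf : Measure (ℕ × ℕ)) (hπinf : IsSteadyStateLaw P₂ Yinf πinf)
    -- the system with `K` parking spaces and power `K`
    {Ω₃ : Type*} [MeasurableSpace Ω₃] (P₃ : Measure Ω₃) [IsProbabilityMeasure P₃]
    (YK : ℝ≥0 → Ω₃ → ℕ × ℕ) (hYK : Charging.IsStation lam μ ν (K : ℕ∞) (K : ℝ) P₃ YK)
    (πK : Measure (ℕ × ℕ)) (hπK : IsSteadyStateLaw P₃ YK πK)
    -- the full parking lot
    {Ω₄ : Type*} [MeasurableSpace Ω₄] (P₄ : Measure Ω₄) [IsProbabilityMeasure P₄]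
    (Zf : ℝ≥0 → Ω₄ → ℕ) (hZf : Charging.IsFullLot μ ν K M P₄ Zf)
    (πf : Measure ℕ) (hπf : IsSteadyStateLaw P₄ Zf πf) :
    -- all expectations are finite (the other three laws have finite support),
    -- and the denominators are positive
    (Integrable (fun x : ℕ × ℕ => (x.1 : ℝ)) πinf ∧
      Integrable (fun x : ℕ × ℕ => (x.1 : ℝ) - (x.2 : ℝ)) πinf ∧
      0 < Charging.meanTotal πinf ∧ 0 < Charging.meanTotal π) ∧
    Charging.meanCharged πinf / Charging.meanTotal πinf
      ≤ Charging.meanCharged π / Charging.meanTotal π ∧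
    Charging.meanCharged π / Charging.meanTotal π
      ≤ Charging.meanCharged πK / Charging.meanTotal π ∧
    (Charging.meanTotal π - ∫ z, (z : ℝ) ∂πf) / Charging.meanTotal π
      ≤ Charging.meanCharged π / Charging.meanTotal π := by
  have hK0 : (0 : ℝ) < K := hM.trans_le hMK
  have hK : 0 < K := by exact_mod_cast hK0
  have hK' : (0 : ℕ∞) < (K : ℕ∞) := by exact_mod_cast hK
  have hQinf := Charging.meanTotal_pos hlam hν hM ENat.top_pos hYinf hπinf
  have hQ := Charging.meanTotal_pos hlam hν hM hK' hY hπ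
  have hCinf := Charging.meanCharged_eq hlam hν hM hYinf hπinf
  have hC := Charging.meanCharged_eq hlam hν hM hY hπ
  have hCK := Charging.meanCharged_eq hlam hν hK0 hYK hπK
  have hFinf := Charging.charging_flow hlam hν hM hYinf hπinf
  have hF := Charging.charging_flow hlam hν hM hY hπ
  have hFK := Charging.charging_flow hlam hν hK0 hYK hπK
  refine ⟨⟨Charging.integrable_fst hlam hν hM hYinf hπinf,
    (Charging.integrable_fst hlam hν hM hYinf hπinf).sub
      (Charging.integrable_snd hlam hν hM hYinf hπinf), hQinf, hQ⟩, ?_, ?_, ?_⟩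
  · have h := mul_le_mul_of_nonneg_left
      (Charging.meanUncharged_mul_le hlam hμ hν hM hY hπ hYinf hπinf) hμ.le
    rw [div_le_div_iff₀ hQinf hQ, hCinf, hC]
    refine le_of_mul_le_mul_left ?_ hν
    -- The flow identities turn the comparison of E[min(Z,M)]/E[Z] into one of E[Q]/E[Z].
    linear_combination h + (∫ x, (x.2 : ℝ) ∂π) * hFinf - (∫ x, (x.2 : ℝ) ∂πinf) * hF
  · have hQK := Charging.meanTotal_eq hlam hν hM hY hπ hK0 hYK hπK
    have h1 := mul_le_mul_of_nonneg_left (Charging.integral_min_snd_le hlam hν hM hY hπ) hμ.le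
    -- Power `K` never limits charging, as `z ≤ q ≤ K` almost surely.
    have h2 : ∫ x, min (x.2 : ℝ) K ∂πK = ∫ x, (x.2 : ℝ) ∂πK := by
      refine integral_congr_ae ?_
      filter_upwards [Charging.ae_mem_states hYK hπK] with x hx
      exact min_eq_left (by exact_mod_cast (Nat.cast_le.2 hx.1).trans hx.2)
    rw [h2] at hFK
    refine div_le_div_of_nonneg_right ?_ hQ.le
    rw [hC, hCK, ← hQK]
    rw [← hQK] at hFK
    refine sub_le_sub_left (le_of_mul_le_mul_left ?_ (add_pos hμ hν)) _
    linarith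
  · refine div_le_div_of_nonneg_right ?_ hQ.le
    rw [hC]
    exact sub_le_sub_left
      (Charging.meanUncharged_le_full hlam hμ hν hM hK hY hπ hZf hπf) _
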